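/- **Setting.** Let $(\Omega,\mathbb P)$ be a probability space with a filtration $(\mathcal B_n)_{n\in\mathbb N}$, let $M\in\mathbb N$, and for each $n\in\mathbb N=\{0,1,2,\dots\}$ let $\mu_n:\mathbb R^M\to[0,\infty)$ be a random Borel function, $\mathcal B_n$-measurable in the sense that $(\omega,x)\mapsto\mu_n(\omega,x)$ is $\mathcal B_n\otimes\mathrm{Borel}$-measurable. Assume that $\mu_0$ is a deterministic bounded function with bounded support, and that there is a deterministic $C<\infty$ such that almost surely $\mu_{n+1}(x)\le C\mu_n(x)$ for all $n$ and $x$. Then $(\mu_n)$ is a *martingale measure* if $\mathbb E(\mu_{n+1}(x)\mid\mathcal B_n)=\mu_n(x)$ almost surely, for every $x\in\mathbb R^M$ and $n\in\mathbb N$. Let $(\Gamma,d)$ be a metric space and $\{\eta_t\}_{t\in\Gamma}$ a family of (deterministic) Borel measures on $\mathbb R^M$. Put $\mu_n^t(A)=\int_A\mu_n\,d\eta_t$ and $Y_n^t=\mu_n^t(\mathbb R^M)=\int\mu_n\,d\eta_t$. Let $\mathcal Q_n$ be the family of half-open dyadic cubes of $\mathbb R^M$ of side length $2^{-n}$. A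 graph on an index set $I$ is a *dependency graph* for random variables $(X_i)_{i\in I}$ if, whenever $i\in I$, $J\subset I\setminus\{i\}$ and no edge joins $i$ to an element of $J$, the variable $X_i$ is independent of $(X_j)_{j\in J}$. The *dependency degree* $\mathcal{DI}_n$ is the (random) smallest number such that, for every $t\in\Gamma$, the random variables $\{\mu_{n+1}^t(Q)\}_{Q\in\mathcal Q_{n+1}}$, under their regular conditional law given $\mathcal B_n$, have a dependency graph with all vertex degrees at most that number. An inequality $\mathcal{DI}_n\le\Psi$ is understood in the following version-independent sense: for each $t\in\Gamma$, almost surely there is such a graph with all degrees at most $\Psi$. The sequence $(\mu_n)$ is *weakly spatially dependent* with parameter $\delta\ge0$ (with respect to $\{\eta_t\}$) if there is a random sequence $\Psi(n)\in[0,\infty]$ with $\mathcal{DI}_n\le\Psi(n)$ for all $n$ such that for every $\varepsilon>0$ there are a deterministic $C>0$, numbers $\varepsilon_n>0$ with $\sum_n\varepsilon_n<\varepsilon$, and events $\mathfrak C_n\in\mathcal B_n$ with $\mathfrak C_0=\Omega$ and $\mathfrak C_n\subset\{\Psi(n)\le C2^{\delta n}\}$ for $n\ge1$, such that for all $n\ge1$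 $$\mathbb P_{\mathfrak C_{n-1}}(\mathfrak C_n\mid\mathcal B_{n-1})\ge1-\varepsilon_n\qquad\mathbb P_{\mathfrak C_{n-1}}\text{-almost surely},$$ where $\mathbb P_{\mathfrak C}=\mathbb P(\,\cdot\mid\mathfrak C)$. **Theorem.** Let $\alpha,\kappa,\theta,\gamma_0>0$ and $\delta\ge0$ satisfy $$\kappa-\alpha-\delta>0.$$ Then there are deterministic numbers $\gamma>0$ and $\rho>0$, depending only on $\alpha,\kappa,\theta,\gamma_0,\delta$, with the following property. Let $(\mu_n)$ be a martingale measure which is weakly spatially dependent with parameter $\delta$ with respect to a family $\{\eta_t\}_{t\in\Gamma}$, in the setting above, and suppose that: 1. $\Gamma$ has finite upper box-counting dimension: there are $C,D>0$ such that for every $r\in(0,1]$, $\Gamma$ can be covered by at most $Cr^{-D}$ balls of radius $r$. 2. The family $\{\eta_t\}$ has Frostman exponent $\kappa$: there is $C>0$ with $\eta_t(B(x,r))\le Cr^\kappa$ for all $t\in\Gamma$, $x\in\mathbb R^M$, $0<r<1$. 3. Almost surely, $\mu_n(x)\le2^{\alpha n}$ for all $n\in\mathbb N$ and $x\in\mathbb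 R^M$. 4. Almost surely, there is a (random) integer $K$ such that $$\sup_{t,u\in\Gamma,\ t\ne u,\ n\ge K}\frac{|Y_n^t-Y_n^u|}{2^{\theta n}\,d(t,u)^{\gamma_0}}<\infty.$$ Then almost surely $Y_n^t$ converges, uniformly in $t$ and exponentially fast, to a limit $Y^t$, that is, there is a (random) $C<\infty$ with $|Y_n^t-Y^t|\le C\,2^{-\rho n}$ for all $n\in\mathbb N$ and $t\in\Gamma$; and the function $t\mapsto Y^t$ is Hölder continuous with exponent $\gamma$: there is a (random) $C<\infty$ with $|Y^t-Y^u|\le C\,d(t,u)^\gamma$ for all $t,u\in\Gamma$. -/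

import Mathlib

open MeasureTheory ProbabilityTheory Set
open scoped NNReal ENNReal

noncomputable section

namespace HolderIntersections

/-- The half-open dyadic cube of `ℝ^M` of side length `2^{-n}` with corner `2^{-n} k`. The family
of all dyadic cubes of level `n` is indexed (bijectively) by `k : Fin M → ℤ`. -/
def dyadicCube (M n : ℕ) (k : Fin M → ℤ) : Set (EuclideanSpace ℝ (Fin M)) :=
  {x | ∀ i, (k i : ℝ) / 2 ^ n ≤ x i ∧ x i < ((k i : ℝ) + 1) / 2 ^ n}

/-- The standing assumptions on a sequence of random densities `μ n ω : ℝ^M → [0, ∞)`, adapted to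
the filtration `ℬ` on the probability space `(Ω, P)`. -/
structure IsRandomDensity {Ω : Type*} [mΩ : MeasurableSpace Ω] (P : Measure Ω)
    (ℬ : Filtration ℕ mΩ) {M : ℕ} (μ : ℕ → Ω → EuclideanSpace ℝ (Fin M) → ℝ≥0) : Prop where
  /-- `μ 0` is a deterministic bounded function with bounded support. -/
  deterministic_zero : ∃ f : EuclideanSpace ℝ (Fin M) → ℝ≥0, (∀ ω, μ 0 ω = f) ∧
    (∃ C : ℝ≥0, ∀ x, f x ≤ C) ∧ Bornology.IsBounded (Function.support f)
  /-- `μ n` is a Borel random function that is measurable with respect to `ℬ n` (jointly in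
  `(ω, x)`, so that its integrals against measures on `ℝ^M` are `ℬ n`-measurable). -/
  measurable : ∀ n, Measurable[(ℬ n).prod inferInstance]
    (fun p : Ω × EuclideanSpace ℝ (Fin M) => μ n p.1 p.2)
  /-- The quotients `μ (n + 1) / μ n` are bounded by a deterministic constant. -/
  quotients_bounded : ∃ C : ℝ≥0, ∀ᵐ ω ∂P, ∀ n x, μ (n + 1) ω x ≤ C * μ n ω x

/-- Martingale measures: `𝔼(μ (n + 1) (x) | ℬ n) = μ n (x)` for every point `x` and every `n`. -/
structure IsMartingaleMeasure {Ω : Type*} [mΩ : MeasurableSpace Ω] (P : Measure Ω)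
    (ℬ : Filtration ℕ mΩ) {M : ℕ} (μ : ℕ → Ω → EuclideanSpace ℝ (Fin M) → ℝ≥0) : Prop
    extends IsRandomDensity P ℬ μ where
  condExp_eq : ∀ n x,
    P[fun ω => (μ (n + 1) ω x : ℝ) | ℬ n] =ᵐ[P] fun ω => (μ n ω x : ℝ)

/-- The intersection `μ_n^t` of the random density `μ n ω` with the measure `η t`, that is,
`μ_n^t (A) = ∫_A μ_n dη_t`. -/
def intersection {Ω Γ : Type*} {M : ℕ} (μ : ℕ → Ω → EuclideanSpace ℝ (Fin M) → ℝ≥0)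
    (η : Γ → Measure (EuclideanSpace ℝ (Fin M))) (n : ℕ) (t : Γ) (ω : Ω) :
    Measure (EuclideanSpace ℝ (Fin M)) :=
  (η t).withDensity (fun x => (μ n ω x : ℝ≥0∞))

/-- The total mass `Y_n^t = ‖μ_n^t‖ = ∫ μ_n dη_t`. -/
def totalMass {Ω Γ : Type*} {M : ℕ} (μ : ℕ → Ω → EuclideanSpace ℝ (Fin M) → ℝ≥0)
    (η : Γ → Measure (EuclideanSpace ℝ (Fin M))) (n : ℕ) (t : Γ) (ω : Ω) : ℝ :=
  (intersection μ η n t ω).real univ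

/-- `G` is a dependency graph for real random variables `(X_i)_{i ∈ I}` with joint law `ν`:
if no edge joins `i` to an element of `J` (where `i ∉ J`), then `X_i` is independent of the family
`(X_j)_{j ∈ J}`. -/
def IsDependencyGraph {I : Type*} (ν : Measure (I → ℝ)) (G : SimpleGraph I) : Prop :=
  ∀ (i : I) (J : Set I), i ∉ J → (∀ j ∈ J, ¬ G.Adj i j) →
    IndepFun (fun x : I → ℝ => x i) (fun (x : I → ℝ) (j : J) => x j) ν

/-- The smallest possible (maximal) degree of a dependency graph for real random variables with
joint law `ν`. -/
def minDependencyDegree {I : Type*} (ν : Measure (I → ℝ)) : ℕ∞ :=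
  ⨅ (G : SimpleGraph I) (_ : IsDependencyGraph ν G), ⨆ i, (G.neighborSet i).encard

/-- The (regular) conditional joint law, given `ℬ n`, of the masses `μ_{n+1}^t (Q)`, where `Q` runs
over the dyadic cubes of side length `2^{-(n+1)}`. -/
def condLawMasses {Ω Γ : Type*} [mΩ : MeasurableSpace Ω] (P : Measure Ω) [IsFiniteMeasure P]
    (ℬ : Filtration ℕ mΩ) {M : ℕ} (μ : ℕ → Ω → EuclideanSpace ℝ (Fin M) → ℝ≥0)
    (η : Γ → Measure (EuclideanSpace ℝ (Fin M))) (n : ℕ) (t : Γ) (ω : Ω) :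
    Measure ((Fin M → ℤ) → ℝ) :=
  @condDistrib Ω Ω ((Fin M → ℤ) → ℝ) _ _ _ mΩ (ℬ n)
    (fun ω k => (intersection μ η (n + 1) t ω).real (dyadicCube M (n + 1) k)) id P _ ω

/-- `Ψ` bounds the dependency degree at step `n`: for every `t`, conditionally on `ℬ n`, the masses
`μ_{n+1}^t (Q)` of the dyadic cubes `Q` of side length `2^{-(n+1)}` have a dependency graph of
degree at most `Ψ`. The conditional law, the graph and `Ψ` are random; conditional laws being
unique only up to null sets, the bound is meant almost surely for each `t`. -/
def DependencyDegreeLE {Ω Γ : Type*} [mΩ : MeasurableSpace Ω] (P : Measure Ω) [IsFiniteMeasure P]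
    (ℬ : Filtration ℕ mΩ) {M : ℕ} (μ : ℕ → Ω → EuclideanSpace ℝ (Fin M) → ℝ≥0)
    (η : Γ → Measure (EuclideanSpace ℝ (Fin M))) (n : ℕ) (Ψ : Ω → ℝ≥0∞) : Prop :=
  ∀ t, ∀ᵐ ω ∂P, (minDependencyDegree (condLawMasses P ℬ μ η n t ω) : ℝ≥0∞) ≤ Ψ ω

/-- Weak spatial dependence with parameter `δ`, with respect to the family `η`. The events `𝔠 n`
are the good events; `P[|𝔠 n]` is `P` conditioned on `𝔠 n`. -/
def IsWeaklySpatiallyDependent {Ω Γ : Type*} [mΩ : MeasurableSpace Ω] (P : Measure Ω)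
    [IsFiniteMeasure P] (ℬ : Filtration ℕ mΩ) {M : ℕ}
    (μ : ℕ → Ω → EuclideanSpace ℝ (Fin M) → ℝ≥0)
    (η : Γ → Measure (EuclideanSpace ℝ (Fin M))) (δ : ℝ) : Prop :=
  ∃ Ψ : ℕ → Ω → ℝ≥0∞,
    (∀ n, DependencyDegreeLE P ℬ μ η n (Ψ n)) ∧
    ∀ ε : ℝ, 0 < ε → ∃ (C : ℝ) (e : ℕ → ℝ) (𝔠 : ℕ → Set Ω),
      0 < C ∧ (∀ n, 0 < e n) ∧ Summable e ∧ ∑' n, e n < ε ∧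
      𝔠 0 = univ ∧
      (∀ n, MeasurableSet[ℬ n] (𝔠 n)) ∧
      (∀ n, 1 ≤ n → 𝔠 n ⊆ {ω | Ψ n ω ≤ ENNReal.ofReal (C * (2 : ℝ) ^ (δ * n))}) ∧
      ∀ n, ∀ᵐ ω ∂P[|𝔠 n], 1 - e (n + 1) ≤ ((P[|𝔠 n])⟦𝔠 (n + 1) | ℬ n⟧) ω

/-- The family `η` has Frostman exponent `κ`, with a uniform constant. -/
def HasFrostmanExponent {Γ : Type*} {M : ℕ} (η : Γ → Measure (EuclideanSpace ℝ (Fin M)))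
    (κ : ℝ) : Prop :=
  ∃ C : ℝ, 0 < C ∧ ∀ t x r, 0 < r → r < 1 →
    η t (Metric.closedBall x r) ≤ ENNReal.ofReal (C * r ^ κ)

/-- `Γ` has finite upper box-counting dimension: for all `r ∈ (0, 1]` it is covered by at most
`C r^{-D}` balls of radius `r`. -/
def HasFiniteUpperBoxDim (Γ : Type*) [MetricSpace Γ] : Prop :=
  ∃ C D : ℝ, 0 < C ∧ 0 < D ∧ ∀ r : ℝ, 0 < r → r ≤ 1 →
    ∃ S : Finset Γ, (S.card : ℝ) ≤ C * r ^ (-D) ∧ ⋃ s ∈ S, Metric.closedBall s r = univ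

end HolderIntersections

end

/-! Cut `ℝ^M` into dyadic cubes `Q` of side `2^{-(n+1)}`. The increment `Y_{n+1}^t - Y_n^t` is the
sum of the differences `μ_{n+1}^t(Q) - μ_n^t(Q)`, which given `ℬ n` are centred, with `0 ≤
μ_{n+1}^t(Q) ≤ C μ_n^t(Q)`, and have a dependency graph of degree at most a constant times `2^{δn}`
on the good event. Colouring this graph greedily gives a Hoeffding bound whose variance proxy is of
order `2^{δn} ∑ μ_n^t(Q)² ≤ 2^{δn} (max_Q μ_n^t(Q)) Y_n^t`, and the density and Frostman bounds make
the maximum of order `2^{(α-κ)n}`. Hence an increment exceeds `2^{-ρn}(1 + Y_n^t)` with probability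
at most `2 exp(-b 2^{(κ-α-δ-2ρ)n})` (`exists_measure_increment_le`).

This beats the exponential cardinality of a `2^{-ξn}`-net of `Γ`, so Borel–Cantelli controls the
increments on nets almost surely (`ae_eventually_increment_lt`); the good events cost only an
arbitrarily small probability.

The rest is deterministic (`exists_holder_limit`). The a priori Hölder bound extends the control
from the nets to `Γ`, the relative increments are summable, so the masses stay bounded and converge
exponentially, and balancing `2^{-ρn}` against `2^{θn} d^{γ₀}` gives the Hölder exponent
`ργ₀/(ρ+θ)`. -/

namespace HolderIntersections

/-! ### Sub-Gaussian sums and tails. -/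

section Subgaussian

variable {Ω : Type*} {mΩ : MeasurableSpace Ω} {ν : Measure Ω}

theorem hasSubgaussianMGF_mono {X : Ω → ℝ} {c c' : ℝ≥0} (h : HasSubgaussianMGF X c ν)
    (hc : c ≤ c') : HasSubgaussianMGF X c' ν where
  integrable_exp_mul := h.integrable_exp_mul
  mgf_le t := (h.mgf_le t).trans <| by gcongr

/-- Sums of (possibly dependent) sub-Gaussian random variables. -/
theorem hasSubgaussianMGF_finset_sum [IsProbabilityMeasure ν] {ι : Type*} (s : Finset ι)
    {X : ι → Ω → ℝ} {c : ι → ℝ≥0} (h : ∀ i ∈ s, HasSubgaussianMGF (X i) (c i) ν) :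
    HasSubgaussianMGF (fun ω => ∑ i ∈ s, X i ω) ((∑ i ∈ s, NNReal.sqrt (c i)) ^ 2) ν := by
  classical
  induction s using Finset.induction_on with
  | empty => simp
  | insert i s hi ih =>
    simp only [Finset.sum_insert hi]
    have := (h i (Finset.mem_insert_self i s)).add
      (ih fun j hj => h j (Finset.mem_insert_of_mem hj))
    simpa using this

/-- Cauchy–Schwarz turns the squared sum of standard deviations into a factor equal to the number of
summands. It is applied to colour classes, where that factor is the number of colours. -/
theorem hasSubgaussianMGF_finset_sum_card [IsProbabilityMeasure ν] {ι : Type*} (s : Finset ι)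
    {X : ι → Ω → ℝ} {c : ι → ℝ≥0} (h : ∀ i ∈ s, HasSubgaussianMGF (X i) (c i) ν) :
    HasSubgaussianMGF (fun ω => ∑ i ∈ s, X i ω) (s.card * ∑ i ∈ s, c i) ν := by
  refine hasSubgaussianMGF_mono (hasSubgaussianMGF_finset_sum s h) ?_
  have := sq_sum_le_card_mul_sum_sq (s := s) (f := fun i => NNReal.sqrt (c i))
  simpa using this

theorem hasSubgaussianMGF_measure_abs_ge_le [IsProbabilityMeasure ν] {X : Ω → ℝ} {c : ℝ≥0}
    (h : HasSubgaussianMGF X c ν) {ε : ℝ} (hε : 0 ≤ ε) :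
    ν.real {ω | ε ≤ |X ω|} ≤ 2 * Real.exp (-ε ^ 2 / (2 * c)) := by
  have h1 := h.measure_ge_le hε
  have h2 := h.neg.measure_ge_le hε
  have : {ω | ε ≤ |X ω|} ⊆ {ω | ε ≤ X ω} ∪ {ω | ε ≤ (-X) ω} := by
    intro ω hω
    simpa [le_abs] using hω
  calc ν.real {ω | ε ≤ |X ω|} ≤ ν.real ({ω | ε ≤ X ω} ∪ {ω | ε ≤ (-X) ω}) := measureReal_mono this
    _ ≤ _ := measureReal_union_le _ _
    _ ≤ _ := by linarith

end Subgaussian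

/-- Greedy colouring of a finite set of vertices. -/
theorem exists_coloring_finset {I : Type*} (G : SimpleGraph I) {d : ℕ}
    (hd : ∀ i, (G.neighborSet i).encard ≤ d) (F : Finset I) :
    ∃ c : I → Fin (d + 1), ∀ i ∈ F, ∀ j ∈ F, G.Adj i j → c i ≠ c j := by
  classical
  induction F using Finset.induction_on with
  | empty => exact ⟨fun _ => 0, by simp⟩
  | insert a F ha ih =>
    obtain ⟨c, hc⟩ := ih
    have hfin : (G.neighborSet a).Finite :=
      Set.finite_of_encard_le_coe (hd a)
    have hcard : (hfin.toFinset.image c).card < Fintype.card (Fin (d + 1)) := by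
      refine lt_of_le_of_lt Finset.card_image_le ?_
      have h := hd a
      rw [hfin.encard_eq_coe_toFinset_card] at h
      simpa [Nat.lt_succ_iff] using h
    obtain ⟨x, hx⟩ : ∃ x, x ∉ hfin.toFinset.image c := by
      by_contra! hcon
      rw [← Finset.card_univ] at hcard
      exact absurd (Finset.card_le_card (fun y _ => hcon y : Finset.univ ⊆ _)) (not_le.2 hcard)
    have hx' : ∀ j, G.Adj a j → c j ≠ x := fun j hj hcj =>
      hx (Finset.mem_image.2 ⟨j, by simpa using hj, hcj⟩)
    refine ⟨Function.update c a x, ?_⟩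
    intro i hi j hj hij
    by_cases hia : i = a
    · subst hia
      have hji : j ≠ i := hij.ne'
      simpa [hji] using (hx' j hij).symm
    · by_cases hja : j = a
      · subst hja
        simpa [hia] using hx' i hij.symm
      · simpa [hia, hja] using hc i (Finset.mem_of_mem_insert_of_ne hi hia) j
          (Finset.mem_of_mem_insert_of_ne hj hja) hij

/-- A finite infimum in `ℕ∞` is attained: being below `d + 1` yields a graph whose degrees are at
most `d`. -/
theorem exists_isDependencyGraph {I : Type*} {ν : Measure (I → ℝ)} {D : ℝ≥0∞} (hD : D ≠ ∞)
    (h : (minDependencyDegree ν : ℝ≥0∞) ≤ D) :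
    ∃ (G : SimpleGraph I) (d : ℕ), IsDependencyGraph ν G ∧ (d : ℝ≥0∞) ≤ D ∧
      ∀ i, (G.neighborSet i).encard ≤ d := by
  have hne : minDependencyDegree ν ≠ ⊤ := by
    intro h'
    rw [h'] at h
    simp at h
    exact hD h
  obtain ⟨d, hd⟩ := ENat.ne_top_iff_exists.1 hne
  have hlt : minDependencyDegree ν < (d : ℕ∞) + 1 := by
    rw [← hd]
    exact_mod_cast Nat.lt_succ_self d
  simp only [minDependencyDegree, iInf_lt_iff] at hlt
  obtain ⟨G, hG, hlt⟩ := hlt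
  refine ⟨G, d, hG, ?_, fun i => ?_⟩
  · rw [← hd] at h
    simpa using h
  · exact (le_iSup (fun i => (G.neighborSet i).encard) i).trans (Order.le_of_lt_add_one hlt)

/-! ### Hoeffding's inequality for dependency graphs. -/

section DependencyGraph

variable {I : Type*} {ν : Measure (I → ℝ)} [IsProbabilityMeasure ν] {G : SimpleGraph I}

/-- On a set without edges, each vertex is independent of all the others jointly, so vertices can be
split off one at a time and the proxies add. -/
theorem IsDependencyGraph.hasSubgaussianMGF_sum_of_independent (hG : IsDependencyGraph ν G)
    (m : I → ℝ) (c : I → ℝ≥0) (W : Finset I) (hW : ∀ i ∈ W, ∀ j ∈ W, ¬ G.Adj i j)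
    (h : ∀ i ∈ W, HasSubgaussianMGF (fun x : I → ℝ => x i - m i) (c i) ν) :
    HasSubgaussianMGF (fun x : I → ℝ => ∑ i ∈ W, (x i - m i)) (∑ i ∈ W, c i) ν := by
  classical
  induction W using Finset.induction_on with
  | empty => simp
  | insert a W ha ih =>
    simp only [Finset.sum_insert ha]
    refine (h a (Finset.mem_insert_self a W)).add_of_indepFun
      (ih (fun i hi j hj => hW i (Finset.mem_insert_of_mem hi) j (Finset.mem_insert_of_mem hj))
        fun i hi => h i (Finset.mem_insert_of_mem hi)) ?_
    have hind := hG a (W : Set I) (by simpa using ha) (fun j hj =>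
      hW a (Finset.mem_insert_self a W) j (Finset.mem_insert_of_mem hj))
    have h1 : Measurable fun y : ℝ => y - m a := by fun_prop
    have h2 : Measurable fun y : ↥(W : Set I) → ℝ => ∑ i : ↥(W : Set I), (y i - m i) := by fun_prop
    have := hind.comp h1 h2
    convert! this using 1
    ext x
    simp only [Function.comp]
    exact (Finset.sum_coe_sort W (fun i => x i - m i)).symm

/-- Sub-Gaussian bound for sums of random variables with a dependency graph. -/
theorem IsDependencyGraph.hasSubgaussianMGF_sum (hG : IsDependencyGraph ν G)
    {d : ℕ} (hd : ∀ i, (G.neighborSet i).encard ≤ d) (m : I → ℝ) (c : I → ℝ≥0) (F : Finset I)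
    (h : ∀ i ∈ F, HasSubgaussianMGF (fun x : I → ℝ => x i - m i) (c i) ν) :
    HasSubgaussianMGF (fun x : I → ℝ => ∑ i ∈ F, (x i - m i)) ((d + 1) * ∑ i ∈ F, c i) ν := by
  classical
  obtain ⟨col, hcol⟩ := exists_coloring_finset G hd F
  -- Proxies add within each colour class, and the `d + 1` classes are then combined by
  -- Cauchy–Schwarz.
  have key := hasSubgaussianMGF_finset_sum_card (ν := ν) (Finset.univ : Finset (Fin (d + 1)))
    (X := fun k x => ∑ i ∈ F with col i = k, (x i - m i))
    (c := fun k => ∑ i ∈ F with col i = k, c i) (fun k _ => by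
      refine hG.hasSubgaussianMGF_sum_of_independent m c _ ?_ ?_
      · intro i hi j hj hij
        simp only [Finset.mem_filter] at hi hj
        exact hcol i hi.1 j hj.1 hij (hi.2.trans hj.2.symm)
      · intro i hi
        exact h i (Finset.mem_filter.1 hi).1)
  simp only [Finset.sum_fiberwise] at key
  simpa using key

/-- Hoeffding's inequality for sums of bounded random variables with a dependency graph. -/
theorem IsDependencyGraph.measure_abs_sum_ge_le (hG : IsDependencyGraph ν G)
    {d : ℕ} (hd : ∀ i, (G.neighborSet i).encard ≤ d) (a : I → ℝ≥0) (F : Finset I)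
    (ha : ∀ i ∈ F, ∀ᵐ x ∂ν, x i ∈ Icc 0 (a i : ℝ)) {v : ℝ≥0}
    (hv : (d + 1) * ∑ i ∈ F, a i ^ 2 ≤ v) {s : ℝ} (hs : 0 ≤ s) :
    ν.real {x | s ≤ |∑ i ∈ F, (x i - ∫ y, y i ∂ν)|} ≤ 2 * Real.exp (-s ^ 2 / (2 * v)) := by
  refine hasSubgaussianMGF_measure_abs_ge_le ?_ hs
  refine hasSubgaussianMGF_mono (hG.hasSubgaussianMGF_sum hd (fun i => ∫ y, y i ∂ν)
    (fun i => a i ^ 2) F fun i hi => ?_) hv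
  -- Hoeffding's lemma gives the proxy `(a i / 2) ^ 2`; the factor `1 / 4` is given up.
  refine hasSubgaussianMGF_mono
    (hasSubgaussianMGF_of_mem_Icc (measurable_pi_apply i).aemeasurable (ha i hi)) ?_
  have : ‖(a i : ℝ) - 0‖₊ = a i := by simp
  rw [this]
  gcongr
  exact half_le_self zero_le

end DependencyGraph

end HolderIntersections

/-! ### Transfer to conditional laws. -/

namespace HolderIntersections

/-- Disintegrating the law of `(Z, X)` reduces the bound to Hoeffding in each fibre, where `a`, `m`,
`v` and `s` are frozen at the value of `Z`. The exponent `b` is uniform over the fibres, so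
integration preserves the bound. -/
theorem condDistrib_dependency_tail {Ω Ω' I : Type*} [mΩ : MeasurableSpace Ω]
    [mΩ' : MeasurableSpace Ω'] [Countable I] (P : Measure Ω) [IsProbabilityMeasure P]
    {Z : Ω → Ω'} (hZ : Measurable Z) {X : Ω → I → ℝ} (hX : Measurable X) (F : Finset I)
    {a : I → Ω' → ℝ≥0} (ha : ∀ i, Measurable (a i)) {m : I → Ω' → ℝ} (hm : ∀ i, Measurable (m i))
    (hXa : ∀ i, ∀ᵐ ω ∂P, X ω i ∈ Icc 0 (a i (Z ω) : ℝ))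
    (hXint : ∀ i, Integrable (fun ω => X ω i) P)
    (hXm : ∀ i, P[fun ω => X ω i | mΩ'.comap Z] =ᵐ[P] fun ω => m i (Z ω))
    {c : Set Ω'} (hc : MeasurableSet c) {D : ℝ≥0}
    (hD : ∀ᵐ ω ∂P, Z ω ∈ c → (minDependencyDegree (condDistrib X Z P (Z ω)) : ℝ≥0∞) ≤ D)
    {v : Ω' → ℝ≥0} (hv : ∀ᵐ ω ∂P, Z ω ∈ c → (D + 1) * ∑ i ∈ F, a i (Z ω) ^ 2 ≤ v (Z ω))
    {s : Ω' → ℝ} (hs : Measurable s) (hs0 : ∀ ω, 0 ≤ s ω) {b : ℝ}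
    (hb : ∀ᵐ ω ∂P, Z ω ∈ c → b ≤ s (Z ω) ^ 2 / (2 * v (Z ω))) :
    P {ω | Z ω ∈ c ∧ s (Z ω) ≤ |∑ i ∈ F, (X ω i - m i (Z ω))|} ≤
      ENNReal.ofReal (2 * Real.exp (-b)) := by
  set A : Set (Ω' × (I → ℝ)) := {p | p.1 ∈ c ∧ s p.1 ≤ |∑ i ∈ F, (p.2 i - m i p.1)|} with hA
  have hAm : MeasurableSet A := by
    refine (measurable_fst hc).inter (measurableSet_le (hs.comp measurable_fst) ?_)
    have : Measurable fun p : Ω' × (I → ℝ) => ∑ i ∈ F, (p.2 i - m i p.1) := by fun_prop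
    exact this.abs
  have hmap : P {ω | Z ω ∈ c ∧ s (Z ω) ≤ |∑ i ∈ F, (X ω i - m i (Z ω))|} =
      (P.map fun ω => (Z ω, X ω)) A := by
    rw [Measure.map_apply (hZ.prodMk hX) hAm]
    rfl
  rw [hmap, ← compProd_map_condDistrib hX.aemeasurable, Measure.compProd_apply hAm,
    lintegral_map (Kernel.measurable_kernel_prodMk_left hAm) hZ]
  have hbd : ∀ᵐ ω ∂P, ∀ i, ∀ᵐ x ∂(condDistrib X Z P (Z ω)), x i ∈ Icc 0 (a i (Z ω) : ℝ) := by
    rw [ae_all_iff]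
    intro i
    have hmeas : MeasurableSet {p : Ω' × (I → ℝ) | p.2 i ∈ Icc 0 (a i p.1 : ℝ)} := by
      refine MeasurableSet.inter (s₁ := {p : Ω' × (I → ℝ) | 0 ≤ p.2 i})
        (s₂ := {p : Ω' × (I → ℝ) | p.2 i ≤ (a i p.1 : ℝ)}) ?_ ?_
      · exact measurableSet_le measurable_const (by fun_prop)
      · exact measurableSet_le (by fun_prop) ((ha i).comp measurable_fst).coe_nnreal_real
    have h1 : ∀ᵐ p ∂(P.map fun ω => (Z ω, X ω)), p.2 i ∈ Icc 0 (a i p.1 : ℝ) := by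
      rw [ae_map_iff (hZ.prodMk hX).aemeasurable hmeas]
      exact hXa i
    rw [← compProd_map_condDistrib hX.aemeasurable] at h1
    exact ae_of_ae_map hZ.aemeasurable (Measure.ae_ae_of_ae_compProd h1)
  -- The centring `m` is the mean of the fibre law, which is where the martingale property will
  -- enter.
  have hmean : ∀ᵐ ω ∂P, ∀ i, ∫ x, x i ∂(condDistrib X Z P (Z ω)) = m i (Z ω) := by
    rw [ae_all_iff]
    intro i
    have h1 := condExp_ae_eq_integral_condDistrib (μ := P) hZ hX.aemeasurable
      (f := fun x : I → ℝ => x i) (measurable_pi_apply i).stronglyMeasurable (hXint i)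
    filter_upwards [h1, hXm i] with ω h1 h2
    rw [← h1, h2]
  calc ∫⁻ ω, (condDistrib X Z P (Z ω)) (Prod.mk (Z ω) ⁻¹' A) ∂P
      ≤ ∫⁻ _, ENNReal.ofReal (2 * Real.exp (-b)) ∂P := by
        refine lintegral_mono_ae ?_
        filter_upwards [hbd, hmean, hD, hv, hb] with ω hbd hmean hD hv hb
        by_cases hω : Z ω ∈ c
        · obtain ⟨G, d, hG, hdD, hd⟩ := exists_isDependencyGraph ENNReal.coe_ne_top (hD hω)
          have hdD' : (d : ℝ≥0) ≤ D := by exact_mod_cast hdD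
          have hv' : ((d : ℝ≥0) + 1) * ∑ i ∈ F, a i (Z ω) ^ 2 ≤ v (Z ω) :=
            le_trans (by gcongr) (hv hω)
          have key := hG.measure_abs_sum_ge_le hd (fun i => a i (Z ω)) F (fun i _ => hbd i) hv'
            (hs0 (Z ω))
          simp only [hmean] at key
          have hset : Prod.mk (Z ω) ⁻¹' A =
              {x : I → ℝ | s (Z ω) ≤ |∑ i ∈ F, (x i - m i (Z ω))|} := by
            ext x
            simp [hA, hω]
          rw [hset, ← ofReal_measureReal]
          refine ENNReal.ofReal_le_ofReal (key.trans ?_)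
          gcongr
          rw [neg_div]
          exact neg_le_neg (hb hω)
        · have hset : Prod.mk (Z ω) ⁻¹' A = ∅ := by
            ext x
            simp [hA, hω]
          simp [hset]
    _ = ENNReal.ofReal (2 * Real.exp (-b)) := by simp

end HolderIntersections

/-! ### Dyadic cubes, Frostman bounds and masses. -/

namespace HolderIntersections

section Cubes

variable {M : ℕ}

theorem measurableSet_dyadicCube (n : ℕ) (k : Fin M → ℤ) : MeasurableSet (dyadicCube M n k) := by
  have : dyadicCube M n k = ⋂ i, {x : EuclideanSpace ℝ (Fin M) |
      (k i : ℝ) / 2 ^ n ≤ x i ∧ x i < ((k i : ℝ) + 1) / 2 ^ n} := by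
    ext x
    simp [dyadicCube]
  rw [this]
  refine MeasurableSet.iInter fun i => ?_
  have hi : Measurable fun x : EuclideanSpace ℝ (Fin M) => x i := by fun_prop
  exact (measurableSet_le measurable_const hi).inter (measurableSet_lt hi measurable_const)

theorem mem_dyadicCube_iff {n : ℕ} {k : Fin M → ℤ} {x : EuclideanSpace ℝ (Fin M)} :
    x ∈ dyadicCube M n k ↔ ∀ i, ⌊x i * 2 ^ n⌋ = k i := by
  refine forall_congr' fun i => ?_
  have : (0 : ℝ) < 2 ^ n := by positivity
  rw [Int.floor_eq_iff, div_le_iff₀ this, lt_div_iff₀ this]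

theorem pairwise_disjoint_dyadicCube (n : ℕ) :
    Pairwise (Function.onFun Disjoint (dyadicCube M n)) := by
  intro k l hkl
  refine Set.disjoint_left.2 fun x hk hl => hkl ?_
  rw [mem_dyadicCube_iff] at hk hl
  ext i
  rw [← hk i, ← hl i]

theorem exists_finset_cover_dyadicCube (n : ℕ) (R : ℝ) :
    ∃ F : Finset (Fin M → ℤ),
      Metric.closedBall (0 : EuclideanSpace ℝ (Fin M)) R ⊆ ⋃ k ∈ F, dyadicCube M n k := by
  classical
  refine ⟨Fintype.piFinset fun _ => Finset.Icc ⌊-(R * 2 ^ n)⌋ ⌊R * 2 ^ n⌋, fun x hx => ?_⟩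
  simp only [mem_iUnion]
  refine ⟨fun i => ⌊x i * 2 ^ n⌋, ?_, mem_dyadicCube_iff.2 fun i => rfl⟩
  rw [Fintype.mem_piFinset]
  intro i
  have h1 : |x i| ≤ R := by
    have h2 := PiLp.norm_apply_le x i
    rw [Real.norm_eq_abs] at h2
    exact h2.trans (by simpa using hx)
  rw [abs_le] at h1
  have : (0 : ℝ) < 2 ^ n := by positivity
  rw [Finset.mem_Icc]
  constructor
  · apply Int.floor_le_floor
    nlinarith
  · apply Int.floor_le_floor
    nlinarith

/-- The summand `1` keeps the radius positive when `M = 0`, as the Frostman bound requires. -/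
theorem dyadicCube_subset_closedBall {n : ℕ} {k : Fin M → ℤ} {x : EuclideanSpace ℝ (Fin M)}
    (hx : x ∈ dyadicCube M n k) :
    dyadicCube M n k ⊆ Metric.closedBall x ((√M + 1) / 2 ^ n) := by
  intro y hy
  rw [Metric.mem_closedBall, EuclideanSpace.dist_eq]
  have hp : (0 : ℝ) < 2 ^ n := by positivity
  calc √(∑ i, dist (y i) (x i) ^ 2) ≤ √(∑ _i : Fin M, (1 / 2 ^ n) ^ 2) := by
        refine Real.sqrt_le_sqrt (Finset.sum_le_sum fun i _ => ?_)
        have h1 := hx i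
        have h2 := hy i
        rw [add_div] at h1 h2
        gcongr
        rw [Real.dist_eq, abs_le]
        constructor <;> linarith
    _ = √M / 2 ^ n := by
        rw [Finset.sum_const, Finset.card_univ, Fintype.card_fin, nsmul_eq_mul,
          Real.sqrt_mul (by positivity), Real.sqrt_sq (by positivity)]
        ring
    _ ≤ (√M + 1) / 2 ^ n := by gcongr; linarith

end Cubes

section Frostman

variable {Γ : Type*} {M : ℕ} {η : Γ → Measure (EuclideanSpace ℝ (Fin M))} {κ : ℝ}

theorem HasFrostmanExponent.isLocallyFiniteMeasure (h : HasFrostmanExponent η κ) (t : Γ) :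
    IsLocallyFiniteMeasure (η t) := by
  obtain ⟨C, -, hC⟩ := h
  exact ⟨fun x => ⟨Metric.closedBall x (1 / 2), Metric.closedBall_mem_nhds x (by norm_num),
    (hC t x (1 / 2) (by norm_num) (by norm_num)).trans_lt ENNReal.ofReal_lt_top⟩⟩

theorem HasFrostmanExponent.exists_measure_le (h : HasFrostmanExponent η κ)
    (R : ℝ) : ∃ K : ℝ≥0, ∀ t, η t (Metric.closedBall 0 R) ≤ K := by
  obtain ⟨C, -, hC⟩ := h
  obtain ⟨S, -, hSf, hS⟩ := (isCompact_closedBall (0 : EuclideanSpace ℝ (Fin M)) R).finite_cover_balls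
    (e := 1 / 2) (by norm_num)
  refine ⟨hSf.toFinset.card * Real.toNNReal (C * (1 / 2) ^ κ), fun t => ?_⟩
  calc η t (Metric.closedBall 0 R) ≤ η t (⋃ x ∈ hSf.toFinset, Metric.closedBall x (1 / 2)) := by
        refine measure_mono (hS.trans ?_)
        simp only [Finite.mem_toFinset]
        exact iUnion₂_mono fun x _ => Metric.ball_subset_closedBall
    _ ≤ ∑ x ∈ hSf.toFinset, η t (Metric.closedBall x (1 / 2)) := measure_biUnion_finset_le _ _
    _ ≤ ∑ x ∈ hSf.toFinset, ENNReal.ofReal (C * (1 / 2) ^ κ) :=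
        Finset.sum_le_sum fun x _ => hC t x (1 / 2) (by norm_num) (by norm_num)
    _ = _ := by
        rw [Finset.sum_const, nsmul_eq_mul]
        push_cast
        rfl

theorem measure_dyadicCube_le {C : ℝ} (hC : ∀ t x r, 0 < r → r < 1 →
    η t (Metric.closedBall x r) ≤ ENNReal.ofReal (C * r ^ κ)) {n : ℕ}
    (hn : (√M + 1) / 2 ^ n < 1) (t : Γ) (k : Fin M → ℤ) :
    η t (dyadicCube M n k) ≤ ENNReal.ofReal (C * ((√M + 1) / 2 ^ n) ^ κ) := by
  rcases (dyadicCube M n k).eq_empty_or_nonempty with h | ⟨x, hx⟩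
  · simp [h]
  · exact (measure_mono (dyadicCube_subset_closedBall hx)).trans (hC t x _ (by positivity) hn)

end Frostman

section Masses

variable {Ω Γ : Type*} {M : ℕ}

theorem intersection_apply (μ : ℕ → Ω → EuclideanSpace ℝ (Fin M) → ℝ≥0)
    (η : Γ → Measure (EuclideanSpace ℝ (Fin M))) (n : ℕ) (t : Γ) (ω : Ω)
    {A : Set (EuclideanSpace ℝ (Fin M))} (hA : MeasurableSet A) :
    intersection μ η n t ω A = ∫⁻ x in A, (μ n ω x : ℝ≥0∞) ∂η t :=
  withDensity_apply _ hA

theorem measurable_lintegral_density [MeasurableSpace Ω] {E : Type*} [MeasurableSpace E]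
    {f : Ω → E → ℝ≥0} (hf : Measurable fun p : Ω × E => f p.1 p.2) (ν : Measure E) [SFinite ν] :
    Measurable fun ω => ∫⁻ x, (f ω x : ℝ≥0∞) ∂ν :=
  Measurable.lintegral_prod_right' (f := fun p : Ω × E => (f p.1 p.2 : ℝ≥0∞)) hf.coe_nnreal_ennreal

variable {μ : ℕ → Ω → EuclideanSpace ℝ (Fin M) → ℝ≥0} {η : Γ → Measure (EuclideanSpace ℝ (Fin M))}

theorem intersection_univ_le {R : ℝ} {K L : ℝ≥0} {n : ℕ} {ω : Ω} {t : Γ}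
    (h : ∀ x, μ n ω x ≤ (Metric.closedBall 0 R).indicator (fun _ => K) x)
    (hL : η t (Metric.closedBall 0 R) ≤ L) : intersection μ η n t ω univ ≤ (K * L : ℝ≥0) := by
  rw [intersection_apply _ _ _ _ _ MeasurableSet.univ, Measure.restrict_univ]
  calc ∫⁻ x, (μ n ω x : ℝ≥0∞) ∂η t
      ≤ ∫⁻ x, (Metric.closedBall 0 R).indicator (fun _ => (K : ℝ≥0∞)) x ∂η t := by
        refine lintegral_mono fun x => ?_
        have := h x
        by_cases hx : x ∈ Metric.closedBall (0 : EuclideanSpace ℝ (Fin M)) R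
        · simpa [indicator_of_mem hx] using this
        · simpa [indicator_of_notMem hx] using this
    _ = K * η t (Metric.closedBall 0 R) := lintegral_indicator_const measurableSet_closedBall _
    _ ≤ K * L := by gcongr
    _ = _ := by push_cast; rfl

/-- The density vanishes outside the ball, so finitely many cubes carry all the mass and a Hoeffding
bound for finite sums suffices. -/
theorem intersection_univ_eq_sum {R : ℝ} {K : ℝ≥0} {n : ℕ} {ω : Ω}
    (h : ∀ x, μ n ω x ≤ (Metric.closedBall 0 R).indicator (fun _ => K) x) (m : ℕ)
    {F : Finset (Fin M → ℤ)}
    (hF : Metric.closedBall (0 : EuclideanSpace ℝ (Fin M)) R ⊆ ⋃ k ∈ F, dyadicCube M m k) (t : Γ) :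
    intersection μ η n t ω univ = ∑ k ∈ F, intersection μ η n t ω (dyadicCube M m k) := by
  have hU : MeasurableSet (⋃ k ∈ F, dyadicCube M m k) :=
    Finset.measurableSet_biUnion F fun k _ => measurableSet_dyadicCube m k
  rw [← measure_biUnion_finset (fun k _ l _ hkl => pairwise_disjoint_dyadicCube m hkl)
    fun k _ => measurableSet_dyadicCube m k, ← measure_add_measure_compl hU]
  convert add_zero _
  rw [intersection_apply _ _ _ _ _ hU.compl, setLIntegral_congr_fun (g := fun _ => 0) hU.compl,
    lintegral_zero]
  intro x hx
  have hx' : x ∉ Metric.closedBall (0 : EuclideanSpace ℝ (Fin M)) R := fun h' => hx (hF h')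
  simpa [indicator_of_notMem hx'] using h x

theorem intersection_succ_le {C : ℝ≥0} {n : ℕ} {ω : Ω}
    (h : ∀ x, μ (n + 1) ω x ≤ C * μ n ω x) (t : Γ)
    {A : Set (EuclideanSpace ℝ (Fin M))} (hA : MeasurableSet A) :
    intersection μ η (n + 1) t ω A ≤ C * intersection μ η n t ω A := by
  rw [intersection_apply _ _ _ _ _ hA, intersection_apply _ _ _ _ _ hA,
    ← lintegral_const_mul' _ _ ENNReal.coe_ne_top]
  refine lintegral_mono fun x => ?_
  rw [← ENNReal.coe_mul]
  exact ENNReal.coe_le_coe.2 (h x)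

theorem intersection_le {a : ℝ≥0} {n : ℕ} {ω : Ω}
    (h : ∀ x, μ n ω x ≤ a) (t : Γ)
    {A : Set (EuclideanSpace ℝ (Fin M))} (hA : MeasurableSet A) :
    intersection μ η n t ω A ≤ a * η t A := by
  rw [intersection_apply _ _ _ _ _ hA, ← setLIntegral_const]
  exact lintegral_mono fun x => ENNReal.coe_le_coe.2 (h x)

variable [mΩ : MeasurableSpace Ω] {P : Measure Ω} {ℬ : Filtration ℕ mΩ}

theorem IsRandomDensity.measurable_prod (h : IsRandomDensity P ℬ μ) (n : ℕ) :
    Measurable fun p : Ω × EuclideanSpace ℝ (Fin M) => μ n p.1 p.2 := by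
  refine (h.measurable n).mono ?_ le_rfl
  exact sup_le_sup (MeasurableSpace.comap_mono (ℬ.le n)) le_rfl

theorem IsRandomDensity.measurable_intersection (h : IsRandomDensity P ℬ μ) (n : ℕ) (t : Γ)
    [SFinite (η t)] {A : Set (EuclideanSpace ℝ (Fin M))} (hA : MeasurableSet A) :
    Measurable[ℬ n] fun ω => intersection μ η n t ω A := by
  simp only [intersection_apply μ η n t _ hA]
  exact @measurable_lintegral_density Ω (ℬ n) _ _ (μ n) (h.measurable n) _ _

theorem IsRandomDensity.measurable_intersection_real (h : IsRandomDensity P ℬ μ) (n : ℕ) (t : Γ)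
    [SFinite (η t)] {A : Set (EuclideanSpace ℝ (Fin M))} (hA : MeasurableSet A) :
    Measurable[ℬ n] fun ω => (intersection μ η n t ω).real A :=
  (h.measurable_intersection n t hA).ennreal_toReal

/-- The densities are bounded and vanish outside a fixed ball. -/
theorem IsRandomDensity.exists_bound (h : IsRandomDensity P ℬ μ) :
    ∃ (R : ℝ) (K : ℕ → ℝ≥0), ∀ᵐ ω ∂P, ∀ n x,
      μ n ω x ≤ (Metric.closedBall 0 R).indicator (fun _ => K n) x := by
  obtain ⟨f, hf, ⟨C₀, hC₀⟩, hsupp⟩ := h.deterministic_zero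
  obtain ⟨C, hC⟩ := h.quotients_bounded
  obtain ⟨R, hR⟩ := hsupp.subset_closedBall 0
  refine ⟨R, fun n => C ^ n * C₀, ?_⟩
  filter_upwards [hC] with ω hω n
  induction n with
  | zero =>
    intro x
    rw [hf ω]
    by_cases hx : x ∈ Metric.closedBall (0 : EuclideanSpace ℝ (Fin M)) R
    · simpa [indicator_of_mem hx] using hC₀ x
    · rw [indicator_of_notMem hx, nonpos_iff_eq_zero]
      by_contra hne
      exact hx (hR hne)
  | succ n ih =>
    intro x
    have h1 := hω n x
    have h2 := ih x
    by_cases hx : x ∈ Metric.closedBall (0 : EuclideanSpace ℝ (Fin M)) R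
    · simp only [indicator_of_mem hx] at h2 ⊢
      calc μ (n + 1) ω x ≤ C * μ n ω x := h1
        _ ≤ C * (C ^ n * C₀) := by gcongr
        _ = _ := by ring
    · simp only [indicator_of_notMem hx, nonpos_iff_eq_zero] at h2 ⊢
      simpa [h2] using h1

theorem IsRandomDensity.exists_intersection_univ_le (h : IsRandomDensity P ℬ μ) {κ : ℝ}
    (hη : HasFrostmanExponent η κ) :
    ∃ K : ℕ → ℝ≥0, ∀ᵐ ω ∂P, ∀ n t, intersection μ η n t ω univ ≤ K n := by
  obtain ⟨R, K, hK⟩ := h.exists_bound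
  obtain ⟨L, hL⟩ := hη.exists_measure_le R
  refine ⟨fun n => K n * L, ?_⟩
  filter_upwards [hK] with ω hω n t
  exact intersection_univ_le (hω n) (hL t)

end Masses

end HolderIntersections

/-! ### Martingale property of the masses and one-step deviations. -/

namespace HolderIntersections

variable {Ω Γ : Type*} {M : ℕ} [mΩ : MeasurableSpace Ω] {P : Measure Ω} {ℬ : Filtration ℕ mΩ}
  {μ : ℕ → Ω → EuclideanSpace ℝ (Fin M) → ℝ≥0} {η : Γ → Measure (EuclideanSpace ℝ (Fin M))}

theorem IsRandomDensity.integrable_density [IsProbabilityMeasure P] (h : IsRandomDensity P ℬ μ)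
    (n : ℕ) (x : EuclideanSpace ℝ (Fin M)) : Integrable (fun ω => (μ n ω x : ℝ)) P := by
  obtain ⟨R, K, hK⟩ := h.exists_bound
  have hmeas : Measurable fun ω => μ n ω x := (h.measurable_prod n).comp (by fun_prop :
    Measurable fun ω : Ω => (ω, x))
  refine Integrable.of_mem_Icc 0 (K n) hmeas.coe_nnreal_real.aemeasurable ?_
  filter_upwards [hK] with ω hω
  refine ⟨by positivity, ?_⟩
  have := (hω n x).trans (indicator_le_self' (fun _ _ => zero_le) x)
  exact_mod_cast this

theorem IsRandomDensity.integrable_intersection [IsProbabilityMeasure P]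
    (h : IsRandomDensity P ℬ μ) {κ : ℝ} (hη : HasFrostmanExponent η κ) (n : ℕ) (t : Γ)
    {A : Set (EuclideanSpace ℝ (Fin M))} (hA : MeasurableSet A) :
    Integrable (fun ω => (intersection μ η n t ω).real A) P := by
  obtain ⟨K, hK⟩ := h.exists_intersection_univ_le hη
  have := hη.isLocallyFiniteMeasure t
  refine Integrable.of_mem_Icc 0 (K n)
    ((h.measurable_intersection_real n t hA).mono (ℬ.le n) le_rfl).aemeasurable ?_
  filter_upwards [hK] with ω hω
  refine ⟨measureReal_nonneg, ?_⟩
  exact ENNReal.toReal_le_coe_of_le_coe ((measure_mono (subset_univ A)).trans (hω n t))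

/-- The null set in the pointwise martingale identity depends on `x`. Integrating over an event of
`ℬ n` removes it and prepares Tonelli's theorem. -/
theorem IsMartingaleMeasure.setLIntegral_succ [IsProbabilityMeasure P]
    (h : IsMartingaleMeasure P ℬ μ) (n : ℕ) (x : EuclideanSpace ℝ (Fin M)) {S : Set Ω}
    (hS : MeasurableSet[ℬ n] S) :
    ∫⁻ ω in S, (μ (n + 1) ω x : ℝ≥0∞) ∂P = ∫⁻ ω in S, (μ n ω x : ℝ≥0∞) ∂P := by
  have hr := h.toIsRandomDensity
  have key : ∫ ω in S, (μ (n + 1) ω x : ℝ) ∂P = ∫ ω in S, (μ n ω x : ℝ) ∂P := by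
    rw [← setIntegral_condExp (ℬ.le n) (hr.integrable_density (n + 1) x) hS]
    exact integral_congr_ae (ae_restrict_of_ae (h.condExp_eq n x))
  have hcoe : ∀ m, ENNReal.ofReal (∫ ω in S, (μ m ω x : ℝ) ∂P) = ∫⁻ ω in S, (μ m ω x : ℝ≥0∞) ∂P := by
    intro m
    rw [ofReal_integral_eq_lintegral_ofReal (hr.integrable_density m x).integrableOn
      (Filter.Eventually.of_forall fun ω => by positivity)]
    simp
  rw [← hcoe, ← hcoe, key]

theorem IsMartingaleMeasure.condExp_intersection [IsProbabilityMeasure P]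
    (h : IsMartingaleMeasure P ℬ μ) {κ : ℝ} (hη : HasFrostmanExponent η κ) (n : ℕ) (t : Γ)
    {A : Set (EuclideanSpace ℝ (Fin M))} (hA : MeasurableSet A) :
    P[fun ω => (intersection μ η (n + 1) t ω).real A | ℬ n] =ᵐ[P]
      fun ω => (intersection μ η n t ω).real A := by
  have hr := h.toIsRandomDensity
  have := hη.isLocallyFiniteMeasure t
  obtain ⟨K, hK⟩ := hr.exists_intersection_univ_le hη
  refine (ae_eq_condExp_of_forall_setIntegral_eq (ℬ.le n)
    (hr.integrable_intersection hη (n + 1) t hA)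
    (fun S _ _ => (hr.integrable_intersection hη n t hA).integrableOn) (fun S hS _ => ?_)
    (hr.measurable_intersection_real n t hA).stronglyMeasurable.aestronglyMeasurable).symm
  have hfub : ∀ m, ∫⁻ ω in S, intersection μ η m t ω A ∂P =
      ∫⁻ x in A, ∫⁻ ω in S, (μ m ω x : ℝ≥0∞) ∂P ∂η t := by
    intro m
    simp only [intersection_apply μ η m t _ hA]
    exact lintegral_lintegral_swap (hr.measurable_prod m).coe_nnreal_ennreal.aemeasurable
  have hint : ∀ m, ∫ ω in S, (intersection μ η m t ω).real A ∂P =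
      (∫⁻ ω in S, intersection μ η m t ω A ∂P).toReal := by
    intro m
    refine integral_toReal
      ((hr.measurable_intersection m t hA).mono (ℬ.le m) le_rfl).aemeasurable
      (ae_restrict_of_ae ?_)
    filter_upwards [hK] with ω hω
    exact ((measure_mono (subset_univ A)).trans (hω m t)).trans_lt ENNReal.coe_lt_top
  rw [hint, hint, hfub, hfub]
  simp only [h.setLIntegral_succ n _ hS]

/-- Large deviation bound for the increments of the total mass. -/
theorem IsMartingaleMeasure.measure_increment_le [IsProbabilityMeasure P]
    (h : IsMartingaleMeasure P ℬ μ) {κ : ℝ} (hη : HasFrostmanExponent η κ) (n : ℕ) (t : Γ)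
    {C : ℝ≥0} (hC0 : 0 < C) (hC : ∀ᵐ ω ∂P, ∀ x, μ (n + 1) ω x ≤ C * μ n ω x)
    {L : ℝ≥0} (hL0 : 0 < L)
    (hL : ∀ᵐ ω ∂P, ∀ k, intersection μ η n t ω (dyadicCube M (n + 1) k) ≤ L)
    {Ψ : Ω → ℝ≥0∞} (hΨ : DependencyDegreeLE P ℬ μ η n Ψ) {D : ℝ≥0} {c : Set Ω}
    (hc : MeasurableSet[ℬ n] c) (hcD : ∀ ω ∈ c, Ψ ω ≤ D) {s : ℝ} (hs : 0 ≤ s) :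
    P {ω | ω ∈ c ∧ s * (1 + totalMass μ η n t ω) ≤
        |totalMass μ η (n + 1) t ω - totalMass μ η n t ω|} ≤
      ENNReal.ofReal (2 * Real.exp (-(s ^ 2 / (2 * ((D + 1) * C ^ 2 * L))))) := by
  have hr := h.toIsRandomDensity
  have := hη.isLocallyFiniteMeasure t
  obtain ⟨K', hK'⟩ := hr.exists_intersection_univ_le hη
  obtain ⟨R, K, hK⟩ := hr.exists_bound
  obtain ⟨F, hF⟩ := exists_finset_cover_dyadicCube (M := M) (n + 1) R
  have hfin : ∀ᵐ ω ∂P, ∀ m A, intersection μ η m t ω A ≠ ∞ := by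
    filter_upwards [hK'] with ω hω m A
    exact (((measure_mono (subset_univ A)).trans (hω m t)).trans_lt ENNReal.coe_lt_top).ne
  have hsum : ∀ᵐ ω ∂P, ∀ m, totalMass μ η m t ω =
      ∑ k ∈ F, (intersection μ η m t ω).real (dyadicCube M (n + 1) k) := by
    filter_upwards [hK, hfin] with ω hω hfin m
    rw [totalMass, Measure.real, intersection_univ_eq_sum (hω m) (n + 1) hF t,
      ENNReal.toReal_sum fun k _ => hfin m _]
    rfl
  set X : Ω → (Fin M → ℤ) → ℝ :=
    fun ω k => (intersection μ η (n + 1) t ω).real (dyadicCube M (n + 1) k) with hXdef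
  set m : (Fin M → ℤ) → Ω → ℝ :=
    fun k ω => (intersection μ η n t ω).real (dyadicCube M (n + 1) k) with hmdef
  have hX : Measurable X := measurable_pi_lambda _ fun k =>
    (hr.measurable_intersection_real (n + 1) t (measurableSet_dyadicCube _ _)).mono
      (ℬ.le _) le_rfl
  have hm : ∀ k, Measurable[ℬ n] (m k) := fun k =>
    hr.measurable_intersection_real n t (measurableSet_dyadicCube _ _)
  have hm0 : ∀ k ω, 0 ≤ m k ω := fun k ω => measureReal_nonneg
  have hY : Measurable[ℬ n] fun ω => totalMass μ η n t ω :=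
    hr.measurable_intersection_real n t MeasurableSet.univ
  have hY0 : ∀ ω, 0 ≤ totalMass μ η n t ω := fun ω => measureReal_nonneg
  -- Conditioning on `ℬ n` is conditioning on the identity map into `(Ω, ℬ n)`, as in
  -- `condLawMasses`.
  have hid : Measurable[mΩ, ℬ n] (id : Ω → Ω) := measurable_id.mono le_rfl (ℬ.le n)
  have key := @condDistrib_dependency_tail Ω Ω (Fin M → ℤ) mΩ (ℬ n) _ P _ id hid X hX F
    (fun k ω => C * (m k ω).toNNReal)
    (fun k => (measurable_const_mul C).comp (hm k).real_toNNReal) m hm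
    (fun k => by
      filter_upwards [hC, hfin] with ω hω hfin
      refine ⟨measureReal_nonneg, ?_⟩
      simp only [id, NNReal.coe_mul, Real.coe_toNNReal _ (hm0 k ω)]
      have := ENNReal.toReal_mono (ENNReal.mul_ne_top ENNReal.coe_ne_top (hfin n _))
        (intersection_succ_le hω t (measurableSet_dyadicCube (n + 1) k))
      simpa [hXdef, hmdef, Measure.real] using this)
    (fun k => hr.integrable_intersection hη (n + 1) t (measurableSet_dyadicCube _ _))
    (fun k => by
      rw [MeasurableSpace.comap_id]
      exact h.condExp_intersection hη n t (measurableSet_dyadicCube _ _))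
    c hc D (by
      filter_upwards [hΨ t] with ω hω hωc
      exact hω.trans (hcD ω hωc))
    -- This proxy works because `∑ m_k² ≤ L ∑ m_k = L Y_n ≤ L (1 + Y_n)`.
    (fun ω => (D + 1) * C ^ 2 * L * (1 + totalMass μ η n t ω).toNNReal) (by
      filter_upwards [hL, hsum] with ω hω hsum _
      simp only [id]
      rw [mul_assoc, mul_assoc]
      refine mul_le_mul_right ?_ _
      simp only [mul_pow, ← Finset.mul_sum]
      refine mul_le_mul_right ?_ _
      calc ∑ k ∈ F, (m k ω).toNNReal ^ 2 ≤ ∑ k ∈ F, L * (m k ω).toNNReal := by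
            refine Finset.sum_le_sum fun k _ => ?_
            rw [sq]
            gcongr
            rw [Real.toNNReal_le_iff_le_coe]
            exact ENNReal.toReal_le_coe_of_le_coe (hω k)
        _ = L * (totalMass μ η n t ω).toNNReal := by
            rw [← Finset.mul_sum, hsum, Real.toNNReal_sum_of_nonneg fun k _ => hm0 k ω]
        _ ≤ _ := by
            gcongr
            linarith)
    (fun ω => s * (1 + totalMass μ η n t ω))
    ((measurable_const_mul s).comp ((measurable_const_add 1).comp hY))
    -- The squared threshold is quadratic in `1 + Y_n` and the proxy linear, so their ratio is least
    -- at `Y_n = 0`; this gives a deterministic exponent.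
    (fun ω => mul_nonneg hs (by linarith [hY0 ω])) (s ^ 2 / (2 * ((D + 1) * C ^ 2 * L))) (by
      refine Filter.Eventually.of_forall fun ω _ => ?_
      have h1 : 1 ≤ 1 + totalMass μ η n t ω := by linarith [hY0 ω]
      have hD0 : 0 < (D : ℝ) + 1 := by positivity
      simp only [id, NNReal.coe_mul, Real.coe_toNNReal _ (zero_le_one.trans h1)]
      push_cast
      have hC0' : 0 < (C : ℝ) := hC0
      have hL0' : 0 < (L : ℝ) := hL0
      rw [div_le_div_iff₀ (by positivity) (by positivity), mul_pow]
      have hpos : 0 ≤ s ^ 2 * (2 * ((D + 1) * C ^ 2 * L)) := by positivity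
      nlinarith [mul_le_mul_of_nonneg_left (mul_le_mul_of_nonneg_left h1 (zero_le_one.trans h1))
        hpos])
  refine le_trans (measure_mono_ae ?_) key
  filter_upwards [hsum] with ω hω hωc
  refine ⟨hωc.1, hωc.2.trans (le_of_eq ?_)⟩
  rw [hω, hω, Finset.sum_sub_distrib]
  rfl

end HolderIntersections

/-! ### Good events and super-exponential tails. -/

namespace HolderIntersections

section Weak

variable {Ω : Type*} {m mΩ : MeasurableSpace Ω} {P : Measure Ω} [IsProbabilityMeasure P]

/-- Integrating the conditional bound gives `P(B | A) ≥ 1 - e`. A null `A` is treated apart, since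
conditioning on it does not give a probability measure. -/
theorem measure_diff_le_of_condExp_ge (hm : m ≤ mΩ) {A B : Set Ω}
    (hA : MeasurableSet A) (hB : MeasurableSet B) {e : ℝ}
    (h : ∀ᵐ ω ∂P[|A], 1 - e ≤ ((P[|A])⟦B | m⟧) ω) : P (A \ B) ≤ ENNReal.ofReal e := by
  by_cases hA0 : P A = 0
  · rw [measure_mono_null sdiff_subset hA0]
    exact zero_le
  have hQ : IsProbabilityMeasure P[|A] := cond_isProbabilityMeasure hA0
  have h1 : 1 - e ≤ (P[|A]).real B := by
    calc 1 - e = ∫ _, (1 - e) ∂P[|A] := by simp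
      _ ≤ ∫ ω, ((P[|A])⟦B | m⟧) ω ∂P[|A] :=
        integral_mono_ae (integrable_const _) integrable_condExp h
      _ = ∫ ω, B.indicator (fun _ => (1 : ℝ)) ω ∂P[|A] := integral_condExp hm
      _ = (P[|A]).real B := by rw [integral_indicator_const _ hB]; simp
  have h2 : (P[|A]).real Bᶜ ≤ e := by
    rw [probReal_compl_eq_one_sub hB]
    linarith
  calc P (A \ B) = P[|A] Bᶜ * P A := by rw [cond_mul_eq_inter hA Bᶜ P]; rfl
    _ ≤ P[|A] Bᶜ * 1 := by gcongr; exact prob_le_one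
    _ = ENNReal.ofReal ((P[|A]).real Bᶜ) := by rw [mul_one, ofReal_measureReal]
    _ ≤ ENNReal.ofReal e := ENNReal.ofReal_le_ofReal h2

theorem measure_compl_iInter_le {ℬ : Filtration ℕ mΩ} {c : ℕ → Set Ω} (hc0 : c 0 = univ)
    (hc : ∀ n, MeasurableSet[ℬ n] (c n)) {e : ℕ → ℝ} (he0 : ∀ n, 0 < e n) (he : Summable e)
    (h : ∀ n, ∀ᵐ ω ∂P[|c n], 1 - e (n + 1) ≤ ((P[|c n])⟦c (n + 1) | ℬ n⟧) ω) :
    P (⋂ n, c n)ᶜ ≤ ENNReal.ofReal (∑' n, e n) := by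
  -- As `c 0` is everything, a point missing some `c n` has a first failure.
  have hsub : (⋂ n, c n)ᶜ ⊆ ⋃ n, c n \ c (n + 1) := by
    intro ω hω
    by_contra hcon
    simp only [mem_iUnion, mem_sdiff, not_exists, not_and, not_not] at hcon
    refine hω (mem_iInter.2 fun n => ?_)
    induction n with
    | zero => simp [hc0]
    | succ n ih => exact hcon n ih
  calc P (⋂ n, c n)ᶜ ≤ ∑' n, P (c n \ c (n + 1)) := (measure_mono hsub).trans (measure_iUnion_le _)
    _ ≤ ∑' n, ENNReal.ofReal (e (n + 1)) := ENNReal.tsum_le_tsum fun n =>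
        measure_diff_le_of_condExp_ge (ℬ.le n) (ℬ.le n _ (hc n)) (ℬ.le _ _ (hc (n + 1))) (h n)
    _ = ENNReal.ofReal (∑' n, e (n + 1)) := by
        rw [ENNReal.ofReal_tsum_of_nonneg (fun n => (he0 _).le) ((summable_nat_add_iff 1).2 he)]
    _ ≤ ENNReal.ofReal (∑' n, e n) := by
        refine ENNReal.ofReal_le_ofReal ?_
        rw [he.tsum_eq_zero_add]
        linarith [he0 0]

end Weak

theorem summable_two_rpow_mul_exp_neg (β : ℝ) {c σ : ℝ} (hc : 0 < c) (hσ : 0 < σ) :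
    Summable fun n : ℕ => (2 : ℝ) ^ (β * n) * Real.exp (-(c * 2 ^ (σ * n))) := by
  -- With `σ k ≥ β + 1`, the bound `exp y ≥ y ^ k / k!` leaves at most a constant times `2^{-n}`.
  obtain ⟨k, hk⟩ := exists_nat_ge ((β + 1) / σ)
  rw [div_le_iff₀ hσ] at hk
  have hgeo : Summable fun n : ℕ => (k.factorial / c ^ k : ℝ) * (1 / 2) ^ n :=
    (summable_geometric_of_lt_one (by norm_num) (by norm_num)).mul_left _
  refine Summable.of_nonneg_of_le (fun n => by positivity) (fun n => ?_) hgeo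
  have hy : 0 < c * (2 : ℝ) ^ (σ * n) := by positivity
  have h1 := Real.pow_div_factorial_le_exp _ hy.le k
  have h2 : Real.exp (-(c * (2 : ℝ) ^ (σ * n))) ≤ k.factorial / (c * (2 : ℝ) ^ (σ * n)) ^ k := by
    rw [Real.exp_neg, ← inv_div]
    exact inv_anti₀ (by positivity) h1
  calc (2 : ℝ) ^ (β * n) * Real.exp (-(c * 2 ^ (σ * n)))
      ≤ (2 : ℝ) ^ (β * n) * (k.factorial / (c * (2 : ℝ) ^ (σ * n)) ^ k) := by gcongr
    _ = (k.factorial / c ^ k) * (2 : ℝ) ^ (β * n - σ * n * k) := by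
        rw [mul_pow, ← Real.rpow_natCast ((2 : ℝ) ^ (σ * n)), ← Real.rpow_mul (by norm_num),
          Real.rpow_sub (by norm_num)]
        field_simp
    _ ≤ (k.factorial / c ^ k) * (1 / 2) ^ n := by
        gcongr
        rw [one_div, inv_pow, ← Real.rpow_natCast, ← Real.rpow_neg (by norm_num)]
        refine Real.rpow_le_rpow_of_exponent_le (by norm_num) ?_
        have : (0 : ℝ) ≤ n := by positivity
        nlinarith

variable {Ω Γ : Type*} {M : ℕ} [mΩ : MeasurableSpace Ω] {P : Measure Ω} {ℬ : Filtration ℕ mΩ}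
  {μ : ℕ → Ω → EuclideanSpace ℝ (Fin M) → ℝ≥0} {η : Γ → Measure (EuclideanSpace ℝ (Fin M))}

/-- Super-exponential tail bound for the increments of the total mass on the good events. -/
theorem IsMartingaleMeasure.exists_measure_increment_le [IsProbabilityMeasure P]
    (h : IsMartingaleMeasure P ℬ μ) {α κ δ : ℝ} (hδ : 0 ≤ δ) (hη : HasFrostmanExponent η κ)
    (hα : ∀ᵐ ω ∂P, ∀ n x, (μ n ω x : ℝ) ≤ (2 : ℝ) ^ (α * n))
    {Ψ : ℕ → Ω → ℝ≥0∞} (hΨ : ∀ n, DependencyDegreeLE P ℬ μ η n (Ψ n)) {C : ℝ} (hC : 0 < C)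
    {c : ℕ → Set Ω} (hc : ∀ n, MeasurableSet[ℬ n] (c n))
    (hcC : ∀ n, 1 ≤ n → c n ⊆ {ω | Ψ n ω ≤ ENNReal.ofReal (C * (2 : ℝ) ^ (δ * n))}) (ρ : ℝ) :
    ∃ b : ℝ, 0 < b ∧ ∀ᶠ n : ℕ in Filter.atTop, ∀ t,
      P {ω | ω ∈ c n ∧ (2 : ℝ) ^ (-(ρ * n)) * (1 + totalMass μ η n t ω) ≤
        |totalMass μ η (n + 1) t ω - totalMass μ η n t ω|} ≤
      ENNReal.ofReal (2 * Real.exp (-(b * 2 ^ ((κ - α - δ - 2 * ρ) * n)))) := by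
  obtain ⟨Cf, hCf, hfro⟩ := id hη
  obtain ⟨q, hq⟩ := h.quotients_bounded
  -- The Frostman bound for cubes of level `n + 1` is `A 2^{-κn}`; the division by `2` is the shift
  -- from `n` to `n + 1`.
  set A : ℝ := Cf * ((√M + 1) / 2) ^ κ with hA
  have hA0 : 0 < A := by positivity
  -- `q + 1` is a positive quotient bound even if `q = 0`, and `C + 1` absorbs the `1` in `D + 1`
  -- because `2^{δn} ≥ 1`.
  refine ⟨1 / (2 * ((C + 1) * (q + 1) ^ 2 * A)), by positivity, ?_⟩
  have hlarge : ∀ᶠ n : ℕ in Filter.atTop, (√M + 1) / (2 : ℝ) ^ (n + 1) < 1 := by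
    have h1 : Filter.Tendsto (fun n : ℕ => (√M + 1) * ((1 : ℝ) / 2) ^ (n + 1)) Filter.atTop
        (nhds ((√M + 1) * 0)) := by
      refine Filter.Tendsto.const_mul _ ?_
      exact (tendsto_pow_atTop_nhds_zero_of_lt_one (by norm_num) (by norm_num)).comp
        (Filter.tendsto_add_atTop_nat 1)
    rw [mul_zero] at h1
    filter_upwards [h1.eventually (gt_mem_nhds one_pos)] with n hn
    rwa [one_div, inv_pow, ← div_eq_mul_inv] at hn
  filter_upwards [hlarge, Filter.eventually_ge_atTop 1] with n hn hn1 t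
  have hLpos : 0 < A * (2 : ℝ) ^ ((α - κ) * n) := by positivity
  have hL : ∀ᵐ ω ∂P, ∀ k, intersection μ η n t ω (dyadicCube M (n + 1) k) ≤
      ((A * (2 : ℝ) ^ ((α - κ) * n)).toNNReal : ℝ≥0) := by
    filter_upwards [hα] with ω hω k
    have h1 := intersection_le (μ := μ) (η := η) (n := n) (ω := ω)
      (a := ((2 : ℝ) ^ (α * n)).toNNReal) (fun x => NNReal.le_toNNReal_of_coe_le (hω n x)) t
      (measurableSet_dyadicCube (n + 1) k)
    refine h1.trans ((mul_le_mul_right (measure_dyadicCube_le hfro hn t k) _).trans (le_of_eq ?_))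
    change ENNReal.ofReal _ * _ = ENNReal.ofReal _
    rw [← ENNReal.ofReal_mul (by positivity)]
    congr 1
    rw [hA, pow_succ, mul_comm ((2 : ℝ) ^ n), ← div_div, Real.div_rpow (by positivity) (by positivity),
      ← Real.rpow_natCast, ← Real.rpow_mul (by norm_num), sub_mul, Real.rpow_sub (by norm_num),
      mul_comm (n : ℝ) κ]
    ring
  have key := h.measure_increment_le hη n t (C := q + 1) (by positivity) (by
      filter_upwards [hq] with ω hω x
      exact (hω n x).trans (by gcongr; simp)) (Real.toNNReal_pos.2 hLpos) hL (hΨ n)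
    (D := (C * (2 : ℝ) ^ (δ * n)).toNNReal) (hc n) (fun ω hω => hcC n hn1 hω)
    (s := (2 : ℝ) ^ (-(ρ * n))) (by positivity)
  refine key.trans (ENNReal.ofReal_le_ofReal ?_)
  gcongr
  rw [Real.coe_toNNReal _ hLpos.le, Real.coe_toNNReal _ (by positivity)]
  have hD1 : 1 ≤ (2 : ℝ) ^ (δ * n) := Real.one_le_rpow (by norm_num) (by positivity)
  calc 1 / (2 * ((C + 1) * (q + 1) ^ 2 * A)) * (2 : ℝ) ^ ((κ - α - δ - 2 * ρ) * n)
      = ((2 : ℝ) ^ (-(ρ * n))) ^ 2 / (2 * (((C + 1) * (2 : ℝ) ^ (δ * n)) * (q + 1) ^ 2 *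
          (A * (2 : ℝ) ^ ((α - κ) * n)))) := by
        have e1 : (2 : ℝ) ^ ((κ - α - δ - 2 * ρ) * n) * ((2 : ℝ) ^ (δ * n) *
            (2 : ℝ) ^ ((α - κ) * n)) = ((2 : ℝ) ^ (-(ρ * n))) ^ 2 := by
          rw [← Real.rpow_add (by norm_num), ← Real.rpow_add (by norm_num), ← Real.rpow_natCast,
            ← Real.rpow_mul (by norm_num)]
          congr 1
          push_cast
          ring
        rw [← e1]
        field_simp
    _ ≤ _ := by
        push_cast
        gcongr
        linarith

end HolderIntersections

/-! ### Borel–Cantelli on nets. -/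

namespace HolderIntersections

/-- Almost surely, the increments of the total mass are eventually exponentially small on nets of
polynomially growing cardinality. -/
theorem IsMartingaleMeasure.ae_eventually_increment_lt {Ω Γ : Type*} {M : ℕ}
    [mΩ : MeasurableSpace Ω] {P : Measure Ω} [IsProbabilityMeasure P] {ℬ : Filtration ℕ mΩ}
    {μ : ℕ → Ω → EuclideanSpace ℝ (Fin M) → ℝ≥0} {η : Γ → Measure (EuclideanSpace ℝ (Fin M))}
    (h : IsMartingaleMeasure P ℬ μ) {α κ δ : ℝ} (hδ : 0 ≤ δ) (hη : HasFrostmanExponent η κ)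
    (hα : ∀ᵐ ω ∂P, ∀ n x, (μ n ω x : ℝ) ≤ (2 : ℝ) ^ (α * n))
    (hw : IsWeaklySpatiallyDependent P ℬ μ η δ) {ρ : ℝ} (hρ : 0 < κ - α - δ - 2 * ρ)
    {S : ℕ → Finset Γ} {B β : ℝ} (hS : ∀ n, ((S n).card : ℝ) ≤ B * 2 ^ (β * n)) :
    ∀ᵐ ω ∂P, ∀ᶠ n : ℕ in Filter.atTop, ∀ t ∈ S n,
      |totalMass μ η (n + 1) t ω - totalMass μ η n t ω| <
        (2 : ℝ) ^ (-(ρ * n)) * (1 + totalMass μ η n t ω) := by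
  obtain ⟨Ψ, hΨ, hw⟩ := hw
  set Q : Ω → Prop := fun ω => ∀ᶠ n : ℕ in Filter.atTop, ∀ t ∈ S n,
      |totalMass μ η (n + 1) t ω - totalMass μ η n t ω| <
        (2 : ℝ) ^ (-(ρ * n)) * (1 + totalMass μ η n t ω) with hQ
  change P {ω | ¬ Q ω} = 0
  -- The good events depend on `ε`, so the exceptional set is shown to have measure at most `ε` for
  -- every `ε`.
  refine nonpos_iff_eq_zero.1 (ENNReal.le_of_forall_pos_le_add fun ε hε _ => ?_)
  rw [zero_add]
  obtain ⟨C, e, c, hC, he0, he, heε, hc0, hc, hcC, hcond⟩ := hw ε hε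
  obtain ⟨b, hb, hN⟩ := h.exists_measure_increment_le hδ hη hα hΨ hC hc hcC ρ
  obtain ⟨N, hN⟩ := Filter.eventually_atTop.1 hN
  set E : ℕ → Γ → Set Ω := fun n t => {ω | ω ∈ c n ∧
    (2 : ℝ) ^ (-(ρ * n)) * (1 + totalMass μ η n t ω) ≤
        |totalMass μ η (n + 1) t ω - totalMass μ η n t ω|} with hE
  have hbound : ∀ n, P (⋃ t ∈ S (n + N), E (n + N) t) ≤ ENNReal.ofReal (2 * B *
      ((2 : ℝ) ^ (β * (n + N : ℕ)) *
        Real.exp (-(b * 2 ^ ((κ - α - δ - 2 * ρ) * (n + N : ℕ)))))) := by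
    intro n
    calc P (⋃ t ∈ S (n + N), E (n + N) t) ≤ ∑ t ∈ S (n + N), P (E (n + N) t) :=
          measure_biUnion_finset_le _ _
      _ ≤ ∑ t ∈ S (n + N), ENNReal.ofReal
            (2 * Real.exp (-(b * 2 ^ ((κ - α - δ - 2 * ρ) * (n + N : ℕ))))) :=
          Finset.sum_le_sum fun t _ => hN (n + N) (by omega) t
      _ = ENNReal.ofReal ((S (n + N)).card *
            (2 * Real.exp (-(b * 2 ^ ((κ - α - δ - 2 * ρ) * (n + N : ℕ)))))) := by
          rw [Finset.sum_const, nsmul_eq_mul, ENNReal.ofReal_mul (Nat.cast_nonneg _),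
            ENNReal.ofReal_natCast]
      _ ≤ _ := by
          refine ENNReal.ofReal_le_ofReal ?_
          refine (mul_le_mul_of_nonneg_right (hS (n + N)) (by positivity)).trans (le_of_eq ?_)
          ring
  have hsum : Summable fun n : ℕ => 2 * B * ((2 : ℝ) ^ (β * (n + N : ℕ)) *
        Real.exp (-(b * 2 ^ ((κ - α - δ - 2 * ρ) * (n + N : ℕ))))) :=
    ((summable_nat_add_iff N).2 (summable_two_rpow_mul_exp_neg β hb hρ)).mul_left _
  have hBC : ∀ᵐ ω ∂P, ∀ᶠ n in Filter.atTop, ω ∉ ⋃ t ∈ S (n + N), E (n + N) t := by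
    refine ae_eventually_notMem (ne_top_of_le_ne_top ?_ (ENNReal.tsum_le_tsum hbound))
    exact hsum.tsum_ofReal_ne_top
  have hsub : ∀ᵐ ω ∂P, ω ∈ {ω | ¬ Q ω} → ω ∈ (⋂ n, c n)ᶜ := by
    filter_upwards [hBC] with ω hω hωQ hωc
    refine hωQ ?_
    obtain ⟨N', hN'⟩ := Filter.eventually_atTop.1 hω
    refine Filter.eventually_atTop.2 ⟨N' + N, fun n hn t ht => ?_⟩
    obtain ⟨k, rfl⟩ := Nat.exists_eq_add_of_le' (le_of_add_le_right hn)
    by_contra hcon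
    refine hN' k (by omega) (mem_iUnion₂.2 ⟨t, ht, mem_iInter.1 hωc _, not_lt.1 hcon⟩)
  calc P {ω | ¬ Q ω} ≤ P (⋂ n, c n)ᶜ := measure_mono_ae hsub
    _ ≤ ENNReal.ofReal (∑' n, e n) := measure_compl_iInter_le hc0 hc he0 he hcond
    _ ≤ ENNReal.ofReal ε := ENNReal.ofReal_le_ofReal heε.le
    _ = ε := ENNReal.ofReal_coe_nnreal

end HolderIntersections

/-! ### Deterministic passage to a Hölder limit. -/

namespace HolderIntersections

/-- A sequence with small relative increments is bounded. -/
theorem one_add_le_of_increments {Γ : Type*} {Y : ℕ → Γ → ℝ} (hY0 : ∀ n t, 0 ≤ Y n t) {q A K : ℝ}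
    (hq0 : 0 < q) (hq1 : q < 1) (hA : 0 ≤ A) {N : ℕ} (hK : ∀ t, Y N t ≤ K)
    (h : ∀ n, N ≤ n → ∀ t, |Y (n + 1) t - Y n t| ≤ A * q ^ n * (1 + Y n t)) :
    ∃ B : ℝ, 0 ≤ B ∧ ∀ n, N ≤ n → ∀ t, 1 + Y n t ≤ B := by
  refine ⟨(1 + |K|) * Real.exp (A * (1 - q)⁻¹), by positivity, fun n hn t => ?_⟩
  -- Each step multiplies `1 + Y` by at most `1 + A q ^ n ≤ exp (A q ^ n)`.
  have key : 1 + Y n t ≤ (1 + |K|) * Real.exp (A * ∑ j ∈ Finset.range n, q ^ j) := by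
    induction n, hn using Nat.le_induction with
    | base =>
      calc 1 + Y N t ≤ (1 + |K|) * 1 := by linarith [hK t, le_abs_self K]
        _ ≤ _ := by
          gcongr
          exact Real.one_le_exp (by positivity)
    | succ n hn ih =>
      have h1 := (abs_le.1 (h n hn t)).2
      rw [Finset.sum_range_succ, mul_add, Real.exp_add, ← mul_assoc]
      calc 1 + Y (n + 1) t ≤ (1 + Y n t) * (A * q ^ n + 1) := by linarith
        _ ≤ _ := by
          have := hY0 n t
          gcongr
          exact Real.add_one_le_exp _
  refine key.trans ?_
  gcongr
  rw [← tsum_geometric_of_lt_one hq0.le hq1]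
  exact (summable_geometric_of_lt_one hq0.le hq1).sum_le_tsum _ fun j _ => by positivity

theorem holderWith_of_abs_sub_le {Γ : Type*} [MetricSpace Γ] {f : Γ → ℝ} {C : ℝ} (hC : 0 ≤ C)
    {γ : ℝ≥0} (h : ∀ u v, u ≠ v → |f u - f v| ≤ C * dist u v ^ (γ : ℝ)) :
    HolderWith C.toNNReal γ f := by
  intro u v
  by_cases huv : u = v
  · simp [huv]
  rw [edist_dist, edist_dist, ENNReal.ofReal_rpow_of_pos (dist_pos.2 huv), Real.dist_eq]
  change _ ≤ ENNReal.ofReal C * _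
  rw [← ENNReal.ofReal_mul hC]
  exact ENNReal.ofReal_le_ofReal (h u v huv)

/-- Exponentially fast uniform limits of functions whose Hölder constants grow at most exponentially
are Hölder continuous. -/
theorem exists_holder_of_exponential_convergence {Γ : Type*} [MetricSpace Γ] {Y : ℕ → Γ → ℝ}
    {f : Γ → ℝ} {ρ θ γ₀ C₀ C₁ K : ℝ} (hρ : 0 < ρ) (hθ : 0 < θ) (hγ₀ : 0 < γ₀) (hC₀ : 0 ≤ C₀)
    (hC₁ : 0 ≤ C₁) (hK0 : 0 ≤ K) (hK : ∀ t, |Y 0 t| ≤ K) {N : ℕ}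
    (hf : ∀ n t, |Y n t - f t| ≤ C₁ * 2 ^ (-(ρ * n)))
    (hY : ∀ n, N ≤ n → ∀ t u, |Y n t - Y n u| ≤ C₀ * ((2 : ℝ) ^ (θ * n) * dist t u ^ γ₀)) :
    ∃ C : ℝ≥0, HolderWith C (ρ * γ₀ / (ρ + θ)).toNNReal f := by
  set γ : ℝ := ρ * γ₀ / (ρ + θ) with hγ
  have hγ0 : 0 < γ := by positivity
  refine ⟨_, holderWith_of_abs_sub_le (C := 2 * C₁ + 2 * K + C₀ * 2 ^ (θ * (N + 1))) (by positivity)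
    fun u v huv => ?_⟩
  rw [Real.coe_toNNReal _ hγ0.le]
  have hd : 0 < dist u v := dist_pos.2 huv
  have hbig : 0 ≤ C₀ * (2 : ℝ) ^ (θ * (N + 1)) := by positivity
  -- At distance at least `1`, boundedness of the limit, read off at `n = 0`, is enough.
  rcases le_or_gt 1 (dist u v) with h1 | h1
  · have hone : 1 ≤ dist u v ^ γ := Real.one_le_rpow h1 hγ0.le
    have e1 := abs_le.1 (hf 0 u)
    have e2 := abs_le.1 (hf 0 v)
    have e3 := abs_le.1 (hK u)
    have e4 := abs_le.1 (hK v)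
    simp only [CharP.cast_eq_zero, mul_zero, neg_zero, Real.rpow_zero, mul_one] at e1 e2
    calc |f u - f v| ≤ 2 * C₁ + 2 * K := by rw [abs_le]; constructor <;> linarith
      _ ≤ (2 * C₁ + 2 * K + C₀ * 2 ^ (θ * (N + 1))) * 1 := by linarith
      _ ≤ _ := by gcongr
  -- This real index balances the two errors: `2^{-ρx} = 2^{θx} d^{γ₀} = d^γ`.
  · set x : ℝ := -Real.logb 2 (dist u v) * (γ₀ / (ρ + θ)) with hx
    have hx0 : 0 ≤ x := by
      have : Real.logb 2 (dist u v) ≤ 0 := Real.logb_nonpos (by norm_num) hd.le h1.le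
      have : 0 ≤ -Real.logb 2 (dist u v) := by linarith
      positivity
    have hdx : dist u v = (2 : ℝ) ^ (-(x * ((ρ + θ) / γ₀))) := by
      rw [hx]
      have : -(-Real.logb 2 (dist u v) * (γ₀ / (ρ + θ)) * ((ρ + θ) / γ₀)) =
        Real.logb 2 (dist u v) := by field_simp
      rw [this, Real.rpow_logb (by norm_num) (by norm_num) hd]
    have hdγ : dist u v ^ γ = (2 : ℝ) ^ (-(ρ * x)) := by
      rw [hdx, ← Real.rpow_mul (by norm_num), hγ]
      congr 1
      field_simp
    have hdγ₀ : dist u v ^ γ₀ = (2 : ℝ) ^ (-((ρ + θ) * x)) := by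
      rw [hdx, ← Real.rpow_mul (by norm_num)]
      congr 1
      field_simp
    -- Adding `N` makes the Hölder bound available; overshooting `x` by at most `N + 1` costs the
    -- factor `2^{θ(N+1)}`.
    set n : ℕ := N + ⌈x⌉₊ with hn
    have hnx : x ≤ n := by
      rw [hn]; push_cast
      linarith [Nat.le_ceil x, (Nat.cast_nonneg N : (0 : ℝ) ≤ N)]
    have hnx' : (n : ℝ) ≤ x + (N + 1) := by
      rw [hn]; push_cast
      linarith [(Nat.ceil_lt_add_one hx0).le]
    have e1 := abs_le.1 (hf n u)
    have e2 := abs_le.1 (hf n v)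
    have e3 := abs_le.1 (hY n (by omega) u v)
    have hq : (2 : ℝ) ^ (-(ρ * n)) ≤ dist u v ^ γ := by
      rw [hdγ]
      exact Real.rpow_le_rpow_of_exponent_le (by norm_num) (by nlinarith)
    have hp : (2 : ℝ) ^ (θ * n) * dist u v ^ γ₀ ≤ 2 ^ (θ * (N + 1)) * dist u v ^ γ := by
      rw [hdγ, hdγ₀, ← Real.rpow_add (by norm_num), ← Real.rpow_add (by norm_num)]
      exact Real.rpow_le_rpow_of_exponent_le (by norm_num) (by nlinarith)
    have hq' := mul_le_mul_of_nonneg_left hq hC₁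
    have hp' := mul_le_mul_of_nonneg_left hp hC₀
    have hK' : 0 ≤ K * dist u v ^ γ := by positivity
    rw [abs_le]
    constructor <;> nlinarith

/-- Control of the increments on fine nets and Hölder continuity with exponentially growing
constants imply exponentially fast convergence to a Hölder continuous limit. -/
theorem exists_holder_limit {Γ : Type*} [MetricSpace Γ] {Y : ℕ → Γ → ℝ} (hY0 : ∀ n t, 0 ≤ Y n t)
    {K : ℕ → ℝ} (hK : ∀ n t, Y n t ≤ K n) {ρ θ γ₀ ξ C₀ : ℝ} (hρ : 0 < ρ) (hρ1 : ρ ≤ 1)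
    (hθ : 0 < θ) (hγ₀ : 0 < γ₀) (hC₀ : 0 ≤ C₀) (hξ : ξ * γ₀ = θ + 1) {N₀ : ℕ}
    (hY : ∀ n, N₀ ≤ n → ∀ t u, |Y n t - Y n u| ≤ C₀ * ((2 : ℝ) ^ (θ * n) * dist t u ^ γ₀))
    {S : ℕ → Finset Γ} (hS : ∀ n u, ∃ t ∈ S n, dist u t ≤ (2 : ℝ) ^ (-(ξ * n)))
    (hinc : ∀ᶠ n : ℕ in Filter.atTop, ∀ t ∈ S n,
      |Y (n + 1) t - Y n t| < (2 : ℝ) ^ (-(ρ * n)) * (1 + Y n t)) :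
    ∃ f : Γ → ℝ, (∃ C : ℝ, ∀ n t, |Y n t - f t| ≤ C * (2 : ℝ) ^ (-(ρ * n))) ∧
      ∃ C : ℝ≥0, HolderWith C (ρ * γ₀ / (ρ + θ)).toNNReal f := by
  obtain ⟨N₁, hinc⟩ := Filter.eventually_atTop.1 hinc
  set q : ℝ := 2 ^ (-ρ) with hqdef
  have hq0 : 0 < q := by positivity
  have hq1 : q < 1 := Real.rpow_lt_one_of_one_lt_of_neg (by norm_num) (by linarith)
  have hqn : ∀ n : ℕ, (2 : ℝ) ^ (-(ρ * n)) = q ^ n := fun n => by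
    rw [hqdef, ← Real.rpow_natCast, ← Real.rpow_mul (by norm_num), neg_mul]
  set N := max N₀ N₁ with hN
  -- Comparison with a net point costs `C₀` at level `n`, `C₀ 2^θ` at level `n + 1`, and another
  -- `C₀` for replacing `Y n t` by `Y n u` in the relative bound.
  set A : ℝ := 1 + 2 * C₀ + C₀ * 2 ^ θ with hA
  have hA0 : 0 ≤ A := by positivity
  have hall : ∀ n, N ≤ n → ∀ u, |Y (n + 1) u - Y n u| ≤ A * q ^ n * (1 + Y n u) := by
    intro n hn u
    obtain ⟨t, ht, hut⟩ := hS n u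
    have h1 : dist u t ^ γ₀ ≤ (2 : ℝ) ^ (-((θ + 1) * n)) := by
      refine (Real.rpow_le_rpow dist_nonneg hut hγ₀.le).trans (le_of_eq ?_)
      rw [← Real.rpow_mul (by norm_num), ← hξ]
      congr 1
      ring
    -- The choice `ξ γ₀ = θ + 1` leaves a spare `2^{-n}`, which is at most `q ^ n` because `ρ ≤ 1`.
    -- The values `a = 0, 1` serve the levels `n` and `n + 1`.
    have hsmall : ∀ a : ℝ, (2 : ℝ) ^ (θ * (n + a)) * dist u t ^ γ₀ ≤ 2 ^ (θ * a) * q ^ n := by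
      intro a
      calc (2 : ℝ) ^ (θ * (n + a)) * dist u t ^ γ₀
          ≤ (2 : ℝ) ^ (θ * (n + a)) * (2 : ℝ) ^ (-((θ + 1) * n)) := by gcongr
        _ = (2 : ℝ) ^ (θ * a) * (2 : ℝ) ^ (-(n : ℝ)) := by
          rw [← Real.rpow_add (by norm_num), ← Real.rpow_add (by norm_num)]
          congr 1
          ring
        _ ≤ (2 : ℝ) ^ (θ * a) * q ^ n := by
          rw [← hqn]
          gcongr
          · norm_num
          · nlinarith [(Nat.cast_nonneg n : (0 : ℝ) ≤ n)]
    have e0 := hsmall 0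
    have e1 := hsmall 1
    simp only [add_zero, mul_zero, mul_one, Real.rpow_zero, one_mul] at e0 e1
    have a0 := abs_le.1 ((hY n (by omega) u t).trans (mul_le_mul_of_nonneg_left e0 hC₀))
    have hY1 := hY (n + 1) (by omega) u t
    push_cast at hY1
    have a1 := abs_le.1 (hY1.trans (mul_le_mul_of_nonneg_left e1 hC₀))
    have a2 := abs_lt.1 (hinc n (by omega) t ht)
    rw [hqn] at a2
    have hqn1 : q ^ n ≤ 1 := pow_le_one₀ hq0.le hq1.le
    have hqn0 : 0 < q ^ n := by positivity
    have hYu := hY0 n u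
    have b1 : q ^ n * (1 + Y n t) ≤ q ^ n * (1 + Y n u + C₀) := by
      refine mul_le_mul_of_nonneg_left ?_ hqn0.le
      have := mul_le_mul_of_nonneg_left hqn1 hC₀
      linarith [a0.1]
    have b2 : q ^ n * (C₀ * (1 + Y n u)) ≥ q ^ n * C₀ := by
      refine mul_le_mul_of_nonneg_left ?_ hqn0.le
      nlinarith
    have b3 : q ^ n * (C₀ * 2 ^ θ * (1 + Y n u)) ≥ q ^ n * (C₀ * 2 ^ θ) := by
      refine mul_le_mul_of_nonneg_left ?_ hqn0.le
      have : 0 ≤ C₀ * (2 : ℝ) ^ θ := by positivity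
      nlinarith
    have hexp : A * q ^ n * (1 + Y n u) = q ^ n * (1 + Y n u) + 2 * (q ^ n * (C₀ * (1 + Y n u))) +
        q ^ n * (C₀ * 2 ^ θ * (1 + Y n u)) := by rw [hA]; ring
    rw [hexp, abs_le]
    constructor <;> nlinarith
  obtain ⟨B, hB0, hB⟩ := one_add_le_of_increments hY0 hq0 hq1 hA0 (hK N) hall
  set K' : ℝ := ∑ j ∈ Finset.range (N + 1), |K j| with hK'
  have hK'j : ∀ j, j ≤ N → ∀ t, Y j t ≤ K' := fun j hj t =>
    (hK j t).trans ((le_abs_self _).trans (Finset.single_le_sum (f := fun j => |K j|)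
      (fun i _ => abs_nonneg _) (Finset.mem_range.2 (by omega))))
  have hK'0 : 0 ≤ K' := Finset.sum_nonneg fun i _ => abs_nonneg _
  -- `A * B` handles `n ≥ N`; for `n < N` the crude bound `K'` is at most `K' / q ^ N * q ^ n`.
  set C₁ : ℝ := A * B + K' / q ^ N with hC₁
  have hC₁0 : 0 ≤ C₁ := by positivity
  have hinc' : ∀ u n, dist (Y n u) (Y (n + 1) u) ≤ C₁ * q ^ n := by
    intro u n
    rw [dist_comm, Real.dist_eq]
    have hqn0 : 0 < q ^ n := by positivity
    have hp : 0 ≤ K' / q ^ N * q ^ n := by positivity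
    have hp' : 0 ≤ A * B * q ^ n := by positivity
    rcases le_or_gt N n with hn | hn
    · calc |Y (n + 1) u - Y n u| ≤ A * q ^ n * (1 + Y n u) := hall n hn u
        _ ≤ A * q ^ n * B := by gcongr; exact hB n hn u
        _ ≤ C₁ * q ^ n := by rw [hC₁]; nlinarith
    · have h1 := hK'j n hn.le u
      have h2 := hK'j (n + 1) hn u
      have h3 : K' ≤ K' / q ^ N * q ^ n := by
        rw [div_mul_eq_mul_div, le_div_iff₀ (by positivity)]
        exact mul_le_mul_of_nonneg_left (pow_le_pow_of_le_one hq0.le hq1.le hn.le) hK'0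
      have h4 := hY0 n u
      have h5 := hY0 (n + 1) u
      calc |Y (n + 1) u - Y n u| ≤ K' := by rw [abs_le]; constructor <;> linarith
        _ ≤ C₁ * q ^ n := by rw [hC₁]; nlinarith
  have hlim : ∀ u, ∃ a, Filter.Tendsto (fun n => Y n u) Filter.atTop (nhds a) := fun u =>
    cauchySeq_tendsto_of_complete (cauchySeq_of_le_geometric q C₁ hq1 (hinc' u))
  choose f hf using hlim
  have hconv : ∀ n t, |Y n t - f t| ≤ C₁ / (1 - q) * (2 : ℝ) ^ (-(ρ * n)) := by
    intro n t
    have := dist_le_of_le_geometric_of_tendsto q C₁ hq1 (hinc' t) (hf t) n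
    rw [Real.dist_eq] at this
    rw [hqn]
    refine this.trans (le_of_eq ?_)
    ring
  refine ⟨f, ⟨_, hconv⟩, ?_⟩
  have h1q : 0 < 1 - q := by linarith
  refine exists_holder_of_exponential_convergence hρ hθ hγ₀ hC₀ (by positivity) hK'0
    (fun t => ?_) hconv hY
  rw [abs_of_nonneg (hY0 0 t)]
  exact hK'j 0 (by omega) t

end HolderIntersections

/-! ### Choice of parameters and conclusion. -/

open HolderIntersections in
theorem mainTheorem3 (α κ θ γ₀ δ : ℝ) (hα : 0 < α) (hκ : 0 < κ) (hθ : 0 < θ) (hγ₀ : 0 < γ₀)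
    (hδ : 0 ≤ δ) (hrel : 0 < κ - α - δ) :
    ∃ (γ : ℝ≥0) (rate : ℝ), 0 < γ ∧ 0 < rate ∧
      ∀ (M : ℕ) (Ω : Type*) (mΩ : MeasurableSpace Ω) (P : Measure Ω) (_ : IsProbabilityMeasure P)
        (ℬ : Filtration ℕ mΩ) (μ : ℕ → Ω → EuclideanSpace ℝ (Fin M) → ℝ≥0)
        (Γ : Type*) (_ : MetricSpace Γ) (η : Γ → Measure (EuclideanSpace ℝ (Fin M))),
        IsMartingaleMeasure P ℬ μ →
        IsWeaklySpatiallyDependent P ℬ μ η δ →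
        HasFiniteUpperBoxDim Γ →
        HasFrostmanExponent η κ →
        (∀ᵐ ω ∂P, ∀ n x, (μ n ω x : ℝ) ≤ (2 : ℝ) ^ (α * n)) →
        (∀ᵐ ω ∂P, ∃ (K : ℕ) (C : ℝ), ∀ n, K ≤ n → ∀ t u : Γ, t ≠ u →
          |totalMass μ η n t ω - totalMass μ η n u ω| / ((2 : ℝ) ^ (θ * n) * dist t u ^ γ₀) ≤ C) →
        ∀ᵐ ω ∂P, ∃ Y : Γ → ℝ,
          (∃ C : ℝ, ∀ n t, |totalMass μ η n t ω - Y t| ≤ C * (2 : ℝ) ^ (-(rate * n))) ∧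
          ∃ C : ℝ≥0, HolderWith C γ Y := by
  -- The quarter keeps `κ - α - δ - 2ρ` positive; the cap `1` serves the comparison `2^{-n} ≤
  -- 2^{-ρn}`.
  set ρ : ℝ := min 1 ((κ - α - δ) / 4) with hρdef
  have hρ : 0 < ρ := lt_min one_pos (by linarith)
  have hρ1 : ρ ≤ 1 := min_le_left _ _
  have hρ2 : 0 < κ - α - δ - 2 * ρ := by
    have : ρ ≤ (κ - α - δ) / 4 := min_le_right _ _
    linarith
  refine ⟨(ρ * γ₀ / (ρ + θ)).toNNReal, ρ, Real.toNNReal_pos.2 (by positivity), hρ, ?_⟩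
  intro M Ω mΩ P _ ℬ μ Γ _ η hμ hw hbox hfro hbd hhol
  obtain ⟨Cb, Db, -, -, hbox⟩ := hbox
  set ξ : ℝ := (θ + 1) / γ₀ with hξdef
  have hξ0 : 0 < ξ := by positivity
  -- Nets of mesh `2^{-ξn}` have cardinality exponential in `n`, which the super-exponential tail
  -- absorbs.
  have hnet : ∀ n : ℕ, ∃ S : Finset Γ, (S.card : ℝ) ≤ Cb * 2 ^ (ξ * Db * n) ∧
      ∀ u, ∃ t ∈ S, dist u t ≤ (2 : ℝ) ^ (-(ξ * n)) := by
    intro n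
    obtain ⟨S, hcard, hcover⟩ := hbox ((2 : ℝ) ^ (-(ξ * n))) (by positivity)
      (Real.rpow_le_one_of_one_le_of_nonpos (by norm_num) (neg_nonpos.2 (by positivity)))
    refine ⟨S, hcard.trans (le_of_eq ?_), fun u => ?_⟩
    · rw [← Real.rpow_mul (by norm_num)]
      congr 2
      ring
    · have hu : u ∈ ⋃ s ∈ S, Metric.closedBall s ((2 : ℝ) ^ (-(ξ * n))) := hcover ▸ Set.mem_univ u
      simpa using hu
  choose S hScard hS using hnet
  obtain ⟨K, hK⟩ := hμ.toIsRandomDensity.exists_intersection_univ_le hfro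
  filter_upwards [hμ.ae_eventually_increment_lt hδ hfro hbd hw hρ2 hScard, hK, hhol]
    with ω hinc hK hhol
  obtain ⟨N, C, hC⟩ := hhol
  refine exists_holder_limit (Y := fun n t => totalMass μ η n t ω) (fun n t => measureReal_nonneg)
    (K := fun n => K n) (fun n t => ENNReal.toReal_le_coe_of_le_coe (hK n t)) hρ hρ1 hθ hγ₀
    (abs_nonneg C) (by rw [hξdef]; field_simp) (N₀ := N) (fun n hn t u => ?_) hS hinc
  by_cases htu : t = u
  · simp [htu, Real.zero_rpow hγ₀.ne']
  · have hd : 0 < dist t u := dist_pos.2 htu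
    rw [← div_le_iff₀ (by positivity)]
    exact (hC n hn t u htu).trans (le_abs_self C)
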